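/- Let $R$ be a left arithmetical ring: every simple left $R$-module is finite and finitely presented, and for each $n\ge 1$ there are only finitely many isomorphism classes of simple left $R$-modules with $n$ elements. Let $G$ be the free commutative monoid (written multiplicatively) on the set of isomorphism classes of simple left $R$-modules, and let $\mathscr N:G\to\mathbb N$ be the homomorphism sending the class of a simple module $S$ to $|S|$. A finite length module $N$ has a class $[N]\in G$, the product of its composition factors with multiplicity. Let $\mathrm{Dir}$ be the algebra of formal sums $\sum_{g\in G}a_g\,g$ with $a_g\in\mathbb C$, with the topology in which a sequence converges if and only if, for each $n$, its coefficients at all $g$ with $\mathscr N(g)\le n$ are eventually equal to those of the limit. For finitely generated left modules $A,C$ put $$Z(A)=\sum_X[A/X]\in\mathrm{Dir},\qquad Z(A,C)=\sum_{X\simeq C}[A/X]\in\mathrm{Dir},$$ the sums being over the finite colength submodules $X$ of $A$ (respectively those isomorphic to $C$). Let $M$ be a finitely generated projective left $R$-module, and let $I$ be a two-sided ideal of $R$ which is invertible (that is, $I\otimes_R-$ is an auto-equivalence of the category of left $R$-modules) and contained in the Jacobson radical of $R$. The simple modules over $R/I$ and over $R$ are then the same, so the zeta functions of $R/I$-modules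 also lie in $\mathrm{Dir}$. Suppose that the finite colength submodules of $M/IM$ are all isomorphic to one another. For a sequence $P=(P_j)_{j\ge0}$ of finitely generated projective left $R/I$-modules, put $$\langle P,N\rangle_j^I=|\mathrm{Hom}(P_j,N)|^{-1}\prod_{k=0}^j|\mathrm{Hom}(P_{j-k},I^k\otimes_R N)|\,[I^k\otimes_R N]\in\mathrm{Dir}$$ for finite length left $R/I$-modules $N$; write $\langle M/IM,-\rangle_j^I$ when $P$ is constantly $M/IM$, so that $$\langle M/IM,N\rangle_j^I=|\mathrm{Hom}(M/IM,N)|^{-1}\prod_{k=0}^j|\mathrm{Hom}(M/IM,I^k\otimes_R N)|\,[I^k\otimes_R N].$$ For a function $\Phi$ on finite length left $R/I$-modules whose value at $N$ depends only on $[N]$, write $Z(A;\Phi)$ and $Z(A,C;\Phi)$ for the result of the change of variable $\sum_g a_g\,g\mapsto\sum_g a_g\,\Phi(g)$ in $Z(A)$ and $Z(A,C)$. Let $\mathcal P$ be the set of sequences of isomorphism classes $([Y_j])_{j\ge 0}$, where $Y_0\subseteq Y_1\subseteq\cdots$ is a chain of finite colength submodules of $M/IM$ with $Y_j=M/IM$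 for all large $j$. Then, for every $P\in\mathcal P$ and for $P$ constantly $M/IM$, the value $\langle P,N\rangle_j^I$ depends only on $[N]$, all the series and products below converge in $\mathrm{Dir}$, and $$Z(M)=\sum_{P\in\mathcal P}\ \prod_{j=0}^\infty Z\bigl(P_{j+1},P_j;\langle P,-\rangle_j^I\bigr)=\prod_{j=0}^\infty Z\bigl(M/IM;\langle M/IM,-\rangle_j^I\bigr).$$ -/

import Mathlib

open scoped TensorProduct

universe u

noncomputable section

namespace BushnellReiner

/-! ### Simple modules, arithmetical rings and the Dirichlet algebra -/

section Arithmetical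

variable (R : Type u) [Ring R]

/-- Two simple left `R`-modules are equivalent when they are isomorphic. -/
instance simpleSetoid : Setoid {S : ModuleCat.{u} R // IsSimpleModule R S} where
  r S T := Nonempty (S.1 ≃ₗ[R] T.1)
  iseqv :=
    { refl := fun S => ⟨LinearEquiv.refl R S.1⟩
      symm := fun ⟨e⟩ => ⟨e.symm⟩
      trans := fun ⟨e⟩ ⟨f⟩ => ⟨e.trans f⟩ }

/-- The set of isomorphism classes of simple left `R`-modules. -/
def SimpleClass : Type (u + 1) := Quotient (simpleSetoid R)

variable {R} in
/-- The isomorphism class of a simple left module. -/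
def SimpleClass.mk (S : Type u) [AddCommGroup S] [Module R S] (hS : IsSimpleModule R S) :
    SimpleClass R :=
  Quotient.mk (simpleSetoid R) ⟨ModuleCat.of R S, hS⟩

variable {R} in
/-- The number of elements of a simple module in the given class (`0` if it is infinite). -/
def SimpleClass.card (s : SimpleClass R) : ℕ :=
  Quotient.lift (s := simpleSetoid R) (fun S => Nat.card S.1)
    (fun _ _ ⟨e⟩ => Nat.card_congr e.toEquiv) s

/-- Left arithmetical rings. -/
structure IsLeftArithmetical : Prop where
  finite_of_simple : ∀ (S : Type u) [AddCommGroup S] [Module R S], IsSimpleModule R S → Finite S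
  finitePresentation_of_simple : ∀ (S : Type u) [AddCommGroup S] [Module R S],
    IsSimpleModule R S → Module.FinitePresentation R S
  finite_classes : ∀ n : ℕ, 0 < n → {s : SimpleClass R | s.card = n}.Finite

/-- The free commutative monoid on the classes of simple modules. It is written additively here:
`g s` is the exponent of `s`. -/
abbrev G : Type (u + 1) := SimpleClass R →₀ ℕ

variable {R} in
/-- The multiplicative extension to `G` of the number of elements. -/
def G.norm (g : G R) : ℕ := g.prod fun s n => s.card ^ n

/-- The Dirichlet algebra: all formal sums `∑ a_g g` over `g ∈ G`, with complex coefficients. -/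
abbrev Dir : Type (u + 1) := MvPowerSeries (SimpleClass R) ℂ

/-- The topology of the nonarchimedean valuation induced by the norm on `G`: its balls are
the sets of series which agree with `f` at all `g` of norm at most `n`. -/
instance Dir.instTopologicalSpace : TopologicalSpace (Dir R) :=
  TopologicalSpace.generateFrom
    {U | ∃ (f : Dir R) (n : ℕ), U = {h : Dir R | ∀ g : G R, g.norm ≤ n →
      MvPowerSeries.coeff g h = MvPowerSeries.coeff g f}}

end Arithmetical

/-! ### Classes of finite length modules, zeta functions -/

section Zeta

variable (R : Type u) [Ring R]

/-- The class in `G` of a composition series: the sum of the classes of its factors. -/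
def seriesClass {N : Type u} [AddCommGroup N] [Module R N]
    (s : CompositionSeries (Submodule R N)) : G R :=
  ∑ i : Fin s.length, Finsupp.single
    (SimpleClass.mk (↥(s i.succ) ⧸ (s i.castSucc).comap (s i.succ).subtype)
      ((covBy_iff_quot_is_simple (s.step i).le).mp (s.step i))) 1

open Classical in
/-- The class `[N]` in `G` of a finite length module: its composition factors, counted with
multiplicity. (By the Jordan–Hölder theorem, any composition series may be taken; modules
which are not of finite length get the value `0` and do not occur below.) -/
def cls (N : Type u) [AddCommGroup N] [Module R N] : G R :=
  if h : IsFiniteLength R N then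
    seriesClass R ((isFiniteLength_iff_exists_compositionSeries (R := R) (M := N)).mp h).choose
  else 0

variable {R} in
/-- An element of `G`, as an element of the Dirichlet algebra. -/
def Dir.ofG (g : G R) : Dir R := MvPowerSeries.monomial g (1 : ℂ)

/-- The finite colength submodules of `M`. -/
abbrev FinColength (M : Type u) [AddCommGroup M] [Module R M] : Type u :=
  {X : Submodule R M // IsFiniteLength R (M ⧸ X)}

/-- The finite colength submodules of `M` which are isomorphic to `N`. -/
abbrev FinColengthIso (M N : Type u) [AddCommGroup M] [Module R M]
    [AddCommGroup N] [Module R N] : Type u :=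
  {X : Submodule R M // IsFiniteLength R (M ⧸ X) ∧ Nonempty (X ≃ₗ[R] N)}

/-- The terms `[M/X]` of the zeta function of `M`. -/
def zetaTerm (M : Type u) [AddCommGroup M] [Module R M] (X : FinColength R M) : Dir R :=
  Dir.ofG (cls R (M ⧸ X.1))

/-- The Bushnell–Reiner zeta function `Z(M)`. -/
def zeta (M : Type u) [AddCommGroup M] [Module R M] : Dir R :=
  ∑' X : FinColength R M, zetaTerm R M X

/-- The terms `[M/X]` of the partial zeta function of `M` and `N`. -/
def partialZetaTerm (M N : Type u) [AddCommGroup M] [Module R M]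
    [AddCommGroup N] [Module R N] (X : FinColengthIso R M N) : Dir R :=
  Dir.ofG (cls R (M ⧸ X.1))

/-- The partial Bushnell–Reiner zeta function `Z(M, N)`. -/
def partialZeta (M N : Type u) [AddCommGroup M] [Module R M]
    [AddCommGroup N] [Module R N] : Dir R :=
  ∑' X : FinColengthIso R M N, partialZetaTerm R M N X

end Zeta

/-! ### The functor `I ⊗ -` and invertible ideals -/

section Tensor

variable {R : Type u} [Ring R] (I : Ideal R)

/-- `x ⊗ n ↦ x ⊗ f n`, before passing to the quotient. -/
def tensorPreMap {N N' : Type u} [AddCommGroup N] [Module R N] [AddCommGroup N'] [Module R N']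
    (f : N →ₗ[R] N') : (I ⊗[ℤ] N) →ₗ[R] (I ⊗[ℤ] N') :=
  TensorProduct.AlgebraTensorModule.map LinearMap.id f.toAddMonoidHom.toIntLinearMap

lemma tensorPreMap_tmul {N N' : Type u} [AddCommGroup N] [Module R N] [AddCommGroup N']
    [Module R N'] (f : N →ₗ[R] N') (x : I) (n : N) :
    tensorPreMap I f (x ⊗ₜ[ℤ] n) = x ⊗ₜ[ℤ] f n := rfl

variable [I.IsTwoSided]

/-- The relations `(x * r) ⊗ n = x ⊗ (r • n)` in `I ⊗[ℤ] N`. Their left `R`-span is the same as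
their additive span. -/
def tensorRel (N : Type u) [AddCommGroup N] [Module R N] : Submodule R (I ⊗[ℤ] N) :=
  Submodule.span R {t | ∃ (x : I) (r : R) (n : N),
    t = (⟨(x : R) * r, I.mul_mem_right r x.2⟩ : I) ⊗ₜ[ℤ] n - x ⊗ₜ[ℤ] (r • n)}

/-- The tensor product `I ⊗_R N` of the bimodule `I` with a left module, as a left module. -/
abbrev Tensor (N : Type u) [AddCommGroup N] [Module R N] : Type u :=
  (I ⊗[ℤ] N) ⧸ tensorRel I N

lemma tensorRel_le_comap {N N' : Type u} [AddCommGroup N] [Module R N] [AddCommGroup N']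
    [Module R N'] (f : N →ₗ[R] N') :
    tensorRel I N ≤ (tensorRel I N').comap (tensorPreMap I f) := by
  refine Submodule.span_le.mpr ?_
  rintro _ ⟨x, r, n, rfl⟩
  refine Submodule.subset_span ⟨x, r, f n, ?_⟩
  rw [map_sub, tensorPreMap_tmul, tensorPreMap_tmul, map_smul]

/-- The map `I ⊗_R f`. -/
def tensorMap {N N' : Type u} [AddCommGroup N] [Module R N] [AddCommGroup N'] [Module R N']
    (f : N →ₗ[R] N') : Tensor I N →ₗ[R] Tensor I N' :=
  Submodule.mapQ (tensorRel I N) (tensorRel I N') (tensorPreMap I f) (tensorRel_le_comap I f)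

lemma tensor_hom_ext {N : Type u} [AddCommGroup N] [Module R N] {P : Type u} [AddCommGroup P]
    [Module R P] {f g : Tensor I N →ₗ[R] P}
    (h : ∀ (x : I) (n : N), f ((tensorRel I N).mkQ (x ⊗ₜ[ℤ] n)) =
      g ((tensorRel I N).mkQ (x ⊗ₜ[ℤ] n))) : f = g := by
  refine LinearMap.ext fun t => ?_
  obtain ⟨t, rfl⟩ := (tensorRel I N).mkQ_surjective t
  induction t with
  | zero => simp
  | tmul x n => exact h x n
  | add a b ha hb => rw [map_add, map_add, map_add, ha, hb]

/-- The functor `I ⊗_R -` on left `R`-modules. -/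
def tensorFunctor : CategoryTheory.Functor (ModuleCat.{u} R) (ModuleCat.{u} R) where
  obj N := ModuleCat.of R (Tensor I N)
  map f := ModuleCat.ofHom (tensorMap I f.hom)
  map_id N := by
    apply ModuleCat.hom_ext
    exact tensor_hom_ext I fun x n => rfl
  map_comp f g := by
    apply ModuleCat.hom_ext
    exact tensor_hom_ext I fun x n => rfl

/-- A two-sided ideal `I` is invertible when `I ⊗_R -` is an auto-equivalence of the category of
left `R`-modules. -/
def IsInvertibleIdeal : Prop := (tensorFunctor I).IsEquivalence

end Tensor

/-! ### Changes of variable and proliferation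

Left `R/I`-modules are regarded as left `R`-modules annihilated by `I`: submodules,
homomorphisms and lengths are then the same. For `I` inside the Jacobson radical, the simple
modules are the same too, so that the zeta functions over `R/I` are elements of `Dir R`. -/

section Prolif

variable {R : Type u} [Ring R] (I : Ideal R)

/-- `N` is a finite length left `R/I`-module. -/
def IsFiniteLengthQuot (N : Type u) [AddCommGroup N] [Module R N] : Prop :=
  IsFiniteLength R N ∧ ∀ a ∈ I, ∀ n : N, a • n = 0

/-- The function `⟨P, -⟩_j^I`, for a sequence `P` of modules:
`|Hom(P_j, N)|⁻¹ ∏_{k ≤ j} |Hom(P_{j-k}, I^k ⊗ N)| [I^k ⊗ N]`. -/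
def bracket [I.IsTwoSided] (P : ℕ → Type u) [∀ j, AddCommGroup (P j)] [∀ j, Module R (P j)]
    (j : ℕ) (N : ModuleCat.{u} R) : Dir R :=
  ((Nat.card (P j →ₗ[R] N) : ℂ)⁻¹) •
    ∏ k ∈ Finset.range (j + 1),
      (Nat.card (P (j - k) →ₗ[R] Tensor (I ^ k) N) : ℂ) • Dir.ofG (cls R (Tensor (I ^ k) N))

/-- A function on finite length `R/I`-modules descends to `G` when its value at `N` depends only
on the class of `N`. -/
def Descends (Φ : ModuleCat.{u} R → Dir R) : Prop :=
  ∀ N N' : ModuleCat.{u} R, IsFiniteLengthQuot I N → IsFiniteLengthQuot I N' →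
    cls R N = cls R N' → Φ N = Φ N'

open Classical in
/-- The function on `G` to which `Φ` descends: its value at `[N]` is `Φ N`. -/
def descend (Φ : ModuleCat.{u} R → Dir R) (g : G R) : Dir R :=
  if h : ∃ N : ModuleCat.{u} R, IsFiniteLengthQuot I N ∧ cls R N = g then Φ h.choose else 0

/-- The terms `a_g Φ(g)` of the series `∑ a_g g` after the change of variable `Φ`. -/
def substTerm (Φ : ModuleCat.{u} R → Dir R) (f : Dir R) (g : G R) : Dir R :=
  MvPowerSeries.coeff g f • descend I Φ g

/-- The change of variable `Φ` in the series `f = ∑ a_g g`, that is, `∑ a_g Φ(g)`. -/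
def subst (Φ : ModuleCat.{u} R → Dir R) (f : Dir R) : Dir R := ∑' g : G R, substTerm I Φ f g

/-- The change of variable `Φ` in the series `f` makes sense. -/
def SubstConverges (Φ : ModuleCat.{u} R → Dir R) (f : Dir R) : Prop :=
  Descends I Φ ∧ Summable (substTerm I Φ f)

variable (M : Type u) [AddCommGroup M] [Module R M]

/-- The module `M/IM`. -/
abbrev ModI : Type u := M ⧸ (I • (⊤ : Submodule R M))

/-- Chains `Y_0 ⊆ Y_1 ⊆ ⋯` of finite colength submodules of `M/IM` which eventually stabilise
to `M/IM`. -/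
structure Chain where
  Y : ℕ → Submodule R (ModI I M)
  mono : Monotone Y
  finColength : ∀ j, IsFiniteLength R (ModI I M ⧸ Y j)
  stable : ∃ n, ∀ j, n ≤ j → Y j = ⊤

/-- Entrywise isomorphism of chains. -/
instance chainSetoid : Setoid (Chain I M) where
  r Y Y' := ∀ j, Nonempty (Y.Y j ≃ₗ[R] Y'.Y j)
  iseqv :=
    { refl := fun Y j => ⟨LinearEquiv.refl R (Y.Y j)⟩
      symm := fun h j => ⟨(h j).some.symm⟩
      trans := fun h h' j => ⟨(h j).some.trans (h' j).some⟩ }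

/-- The set of sequences of isomorphism classes `([Y_j])` which come from a chain. -/
def ChainClass : Type u := Quotient (chainSetoid I M)

variable {I M} in
/-- A sequence of modules `P_j` which represents the given sequence of isomorphism classes. -/
abbrev ChainClass.rep (P : ChainClass I M) (j : ℕ) : Type u := (Quotient.out P).Y j

variable {I M} in
/-- The factor `Z(P_{j+1}, P_j; ⟨P, -⟩_j^I)`. -/
def prolifFactor [I.IsTwoSided] (P : ChainClass I M) (j : ℕ) : Dir R :=
  subst I (bracket I P.rep j) (partialZeta R (P.rep (j + 1)) (P.rep j))

/-- The proliferation of `M/IM` by `I ⊗ -`. -/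
def prolif [I.IsTwoSided] : Dir R := ∑' P : ChainClass I M, ∏' j : ℕ, prolifFactor P j

/-- All the series and products in the definition of the proliferation are well defined and
converge. -/
def ProlifConverges [I.IsTwoSided] : Prop :=
  (∀ (P : ChainClass I M) (j : ℕ),
    Summable (partialZetaTerm R (P.rep (j + 1)) (P.rep j)) ∧
    SubstConverges I (bracket I P.rep j) (partialZeta R (P.rep (j + 1)) (P.rep j))) ∧
  (∀ P : ChainClass I M, Multipliable (prolifFactor P)) ∧
  Summable fun P : ChainClass I M => ∏' j : ℕ, prolifFactor P j

end Prolif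

end BushnellReiner

end

noncomputable section

namespace BushnellReiner

/-! ### Classes of finite length modules -/

section Classes

variable {R : Type u} [Ring R]

/-! To a finite colength submodule `X` of `M` attach the pair `X' = colon I X`, `Y = X + IM`. Since
`I` is invertible, multiplication by `I` identifies the submodules of `M` with those of `IM`; hence
`X ∩ IM = I X'` and `IM / I X'` is `I ⊗ (M/X')`. So `[M/X]` is the product of `[M/Y]` and the shift
of `[M/X']`, where the shift is the permutation of simple classes induced by `I ⊗ -`
(`cls_quotient_eq_shift_add`). The `X` with a given pair are the relative complements of `X' ∩ IM`
in the interval from `I X'` to `X' ∩ Y`. The quotient `(X' ∩ Y)/(X' ∩ IM)` is `Y/IM`, hence `M/IM`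
by the isomorphism hypothesis; the extension splits, and complements are counted by homomorphisms
out of `M`. As `M` is projective, that number depends only on classes (`homCard_cls`, `card_fiber`).

This gives a recursion. The series `remainder j` is a weighted form of `Z(M)`, equal to it for `j =
0`, and `remainder j = factorSeries j * remainder (j + 1)` (`remainder_eq_mul`): for fixed `X'`, the
sum over `Y` between `IM` and `X' + IM` is again a series over the submodules of `M/IM`. By
Nakayama, each term of `remainder j` other than that of `X = M` lives in degree at least `j`, so the
remainders tend to `1` and the product converges to `Z(M)` (`hasProd_factorSeries`).

For the proliferation, the hypothesis makes all chains entrywise isomorphic and the condition `X ≃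
P_j` automatic, so the outer sum has a single term, with the same factors. Convergence is
coefficientwise (`topology_eq`) and rests on the finiteness of the set of submodules with a given
quotient class (`finite_submodules`). -/

lemma SimpleClass.mk_eq_mk {S T : Type u} [AddCommGroup S] [Module R S] [AddCommGroup T]
    [Module R T] {hS : IsSimpleModule R S} {hT : IsSimpleModule R T} (e : S ≃ₗ[R] T) :
    SimpleClass.mk S hS = SimpleClass.mk T hT :=
  Quotient.sound (s := simpleSetoid R) ⟨e⟩

lemma SimpleClass.nonempty_equiv_of_mk_eq {S T : Type u} [AddCommGroup S] [Module R S]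
    [AddCommGroup T] [Module R T] {hS : IsSimpleModule R S} {hT : IsSimpleModule R T}
    (h : SimpleClass.mk S hS = SimpleClass.mk T hT) : Nonempty (S ≃ₗ[R] T) :=
  Quotient.exact (s := simpleSetoid R) h

lemma SimpleClass.ind {p : SimpleClass R → Prop}
    (h : ∀ (S : Type u) [AddCommGroup S] [Module R S] (hS : IsSimpleModule R S),
      p (SimpleClass.mk S hS)) (s : SimpleClass R) : p s :=
  Quotient.ind (s := simpleSetoid R) (fun S => h S.1 S.2) s

variable {N : Type u} [AddCommGroup N] [Module R N]

/-- The class of the simple factor `B / A` of a covering pair of submodules. -/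
def factorClass {A B : Submodule R N} (h : A ⋖ B) : SimpleClass R :=
  SimpleClass.mk (↥B ⧸ A.comap B.subtype) ((covBy_iff_quot_is_simple h.le).mp h)

lemma factorClass_congr {A B A' B' : Submodule R N} (h : A ⋖ B) (hA : A = A') (hB : B = B') :
    factorClass h = factorClass (hA ▸ hB ▸ h : A' ⋖ B') := by
  subst hA hB; rfl

/-- Jordan–Hölder matches the factors up to isomorphism. This is what makes `cls` independent of the
series chosen in its definition. -/
lemma seriesClass_eq_of_head_last {s t : CompositionSeries (Submodule R N)}
    (hh : s.head = t.head) (hl : s.last = t.last) : seriesClass R s = seriesClass R t := by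
  obtain ⟨e, he⟩ := CompositionSeries.jordan_holder s t hh hl
  exact Fintype.sum_equiv e _ _ fun i => by
    rw [SimpleClass.mk_eq_mk (he i).linearEquiv]

lemma cls_eq_seriesClass (s : CompositionSeries (Submodule R N)) (hh : s.head = ⊥)
    (hl : s.last = ⊤) : cls R N = seriesClass R s := by
  have h : IsFiniteLength R N := isFiniteLength_iff_exists_compositionSeries.mpr ⟨s, hh, hl⟩
  rw [cls, dif_pos h]
  have := ((isFiniteLength_iff_exists_compositionSeries (R := R) (M := N)).mp h).choose_spec
  exact seriesClass_eq_of_head_last (this.1.trans hh.symm) (this.2.trans hl.symm)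

variable {N' : Type u} [AddCommGroup N'] [Module R N']

/-- A submodule lying between the images is contained in the range of `f`, so it is itself the image
of its preimage. -/
lemma covBy_map {f : N →ₗ[R] N'} (hf : Function.Injective f) {A B : Submodule R N}
    (h : A ⋖ B) : A.map f ⋖ B.map f := by
  refine ⟨(Submodule.map_strictMono_of_injective hf) h.1, fun C h1 h2 => ?_⟩
  have hC : (C.comap f).map f = C := by
    rw [Submodule.map_comap_eq, inf_eq_right]
    exact h2.le.trans LinearMap.map_le_range
  rw [← hC] at h1 h2
  exact h.2 ((Submodule.map_lt_map_iff_of_injective hf).mp h1)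
    ((Submodule.map_lt_map_iff_of_injective hf).mp h2)

/-- The image of a composition series under an injective map. -/
def mapSeries (f : N →ₗ[R] N') (hf : Function.Injective f)
    (s : CompositionSeries (Submodule R N)) : CompositionSeries (Submodule R N') where
  length := s.length
  toFun i := (s i).map f
  step i := covBy_map hf (s.step i)

lemma factorClass_map {f : N →ₗ[R] N'} (hf : Function.Injective f) {A B : Submodule R N}
    (h : A ⋖ B) : factorClass (covBy_map hf h) = factorClass h := by
  refine (SimpleClass.mk_eq_mk
    (Submodule.Quotient.equiv _ _ (B.equivMapOfInjective f hf) ?_)).symm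
  ext ⟨_, b, hb, rfl⟩
  simp only [Submodule.mem_map, Submodule.mem_comap, Submodule.subtype_apply]
  constructor
  · rintro ⟨y, hy, h⟩
    exact ⟨y, hy, congrArg Subtype.val h⟩
  · rintro ⟨y, hy, h⟩
    exact ⟨⟨b, hb⟩, hf h ▸ hy, rfl⟩

lemma seriesClass_mapSeries (f : N →ₗ[R] N') (hf : Function.Injective f)
    (s : CompositionSeries (Submodule R N)) : seriesClass R (mapSeries f hf s) = seriesClass R s :=
  Fintype.sum_congr _ _ fun i =>
    congrArg (Finsupp.single · 1) (factorClass_map hf (s.step i))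

lemma cls_congr (e : N ≃ₗ[R] N') : cls R N = cls R N' := by
  by_cases h : IsFiniteLength R N
  · obtain ⟨s, hh, hl⟩ := isFiniteLength_iff_exists_compositionSeries.mp h
    rw [cls_eq_seriesClass s hh hl, ← seriesClass_mapSeries (e : N →ₗ[R] N') e.injective s]
    refine (cls_eq_seriesClass _ ?_ ?_).symm
    · change s.head.map _ = ⊥
      rw [hh, Submodule.map_bot]
    · change s.last.map _ = ⊤
      rw [hl, Submodule.map_top, LinearEquiv.range]
  · rw [cls, dif_neg h, cls, dif_neg fun h' => h (e.symm.isFiniteLength h')]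

lemma cls_of_subsingleton [Subsingleton N] : cls R N = 0 := by
  rw [cls_eq_seriesClass (RelSeries.singleton _ ⊥) rfl (Subsingleton.elim _ _)]
  rfl

/-- A composition series of `X`, pushed into `N` and extended by `⊤`, is one of `N`. This matches
the inductive form of `IsFiniteLength`, so later facts about classes follow by induction on it. -/
lemma cls_of_simple_quotient {X : Submodule R N} (hX : IsSimpleModule R (N ⧸ X))
    (h : IsFiniteLength R X) :
    cls R N = cls R X + Finsupp.single (SimpleClass.mk (N ⧸ X) hX) 1 := by
  obtain ⟨s, hh, hl⟩ := isFiniteLength_iff_exists_compositionSeries.mp h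
  let t := mapSeries X.subtype X.injective_subtype s
  have htl : t.last = X := by
    change s.last.map _ = X
    rw [hl, Submodule.map_top, Submodule.range_subtype]
  have hcov : X ⋖ ⊤ := covBy_top_iff.mpr (isSimpleModule_iff_isCoatom.mp hX)
  have hc : t.last ⋖ ⊤ := htl ▸ hcov
  let w : CompositionSeries (Submodule R N) := t.snoc ⊤ hc
  have hw : seriesClass R w = seriesClass R t + Finsupp.single (factorClass hc) 1 := by
    have h1 : ∀ i : Fin (t.length + 1), w (Fin.castSucc (n := t.length + 1) i) = t i :=
      fun i => RelSeries.snoc_castSucc t ⊤ hc i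
    have h2 : w (Fin.last (t.length + 1)) = ⊤ := RelSeries.last_snoc' t ⊤ hc
    refine (Fin.sum_univ_castSucc (n := t.length) _).trans ?_
    congr 1
    · refine Fintype.sum_congr _ _ fun i => congrArg (Finsupp.single · 1) ?_
      exact factorClass_congr (w.step _) (h1 i.castSucc) (h1 i.succ)
    · exact congrArg (Finsupp.single · 1)
        (factorClass_congr (w.step (Fin.last t.length)) (h1 (Fin.last _)) h2)
  rw [cls_eq_seriesClass w ?_ (RelSeries.last_snoc _ _ _), hw, seriesClass_mapSeries,
    cls_eq_seriesClass s hh hl, factorClass_congr hc htl rfl]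
  · congr 2
    refine SimpleClass.mk_eq_mk (Submodule.Quotient.equiv _ _ Submodule.topEquiv ?_)
    ext x
    simp
  · refine (RelSeries.head_snoc _ _ _).trans ?_
    change s.head.map _ = ⊥
    rw [hh, Submodule.map_bot]

lemma cls_simple (h : IsSimpleModule R N) :
    cls R N = Finsupp.single (SimpleClass.mk N h) 1 := by
  have hX : IsSimpleModule R (N ⧸ (⊥ : Submodule R N)) :=
    IsSimpleModule.congr (Submodule.quotEquivOfEqBot ⊥ rfl)
  rw [cls_of_simple_quotient hX .of_subsingleton, cls_of_subsingleton, zero_add,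
    SimpleClass.mk_eq_mk (Submodule.quotEquivOfEqBot ⊥ rfl)]

lemma isFiniteLength_submodule (h : IsFiniteLength R N) (X : Submodule R N) :
    IsFiniteLength R X := h.of_injective X.injective_subtype

lemma isFiniteLength_of_submodule_quotient (X : Submodule R N) (h : IsFiniteLength R X)
    (h' : IsFiniteLength R (N ⧸ X)) : IsFiniteLength R N := by
  rw [isFiniteLength_iff_isNoetherian_isArtinian] at *
  exact ⟨(isNoetherian_iff_submodule_quotient X).mpr ⟨h.1, h'.1⟩,
    (isArtinian_iff_submodule_quotient X).mpr ⟨h.2, h'.2⟩⟩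

/-- Induction on the length of the target: pulling back a maximal `T` along `f` keeps the kernel and
removes the same simple quotient from source and target. -/
lemma cls_eq_ker_add {Q : Type u} [AddCommGroup Q] [Module R Q] (h : IsFiniteLength R N)
    {f : N →ₗ[R] Q} (hf : Function.Surjective f) :
    cls R N = cls R (LinearMap.ker f) + cls R Q := by
  have hQ : IsFiniteLength R Q := h.of_surjective hf
  induction hQ generalizing N with
  | @of_subsingleton Q _ _ _ =>
    rw [cls_of_subsingleton (R := R) (N := Q), add_zero]
    exact cls_congr (LinearEquiv.ofTop _ (by rw [Subsingleton.elim f 0, LinearMap.ker_zero])).symm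
  | @of_simple_quotient Q _ _ T hT hTf ih =>
    let g : T.comap f →ₗ[R] T := f.restrict fun _ h => h
    have hg : Function.Surjective g := by
      rintro ⟨t, ht⟩
      obtain ⟨x, rfl⟩ := hf t
      exact ⟨⟨x, ht⟩, rfl⟩
    have hX := isFiniteLength_submodule h (T.comap f)
    let e : (N ⧸ T.comap f) ≃ₗ[R] Q ⧸ T :=
      (Submodule.quotEquivOfEq _ _ (by rw [LinearMap.ker_comp, Submodule.ker_mkQ])).trans
      ((T.mkQ ∘ₗ f).quotKerEquivOfSurjective (T.mkQ_surjective.comp hf))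
    have hs : IsSimpleModule R (N ⧸ T.comap f) := IsSimpleModule.congr e
    let k : LinearMap.ker g ≃ₗ[R] LinearMap.ker f :=
      LinearEquiv.ofBijective
        (((T.comap f).subtype ∘ₗ (LinearMap.ker g).subtype).codRestrict (LinearMap.ker f)
          fun x => congrArg Subtype.val x.2)
        ⟨fun x y hxy => Subtype.ext (Subtype.ext (Subtype.ext_iff.mp hxy :)), fun x =>
          ⟨⟨⟨x.1, by rw [Submodule.mem_comap, show f x.1 = 0 from x.2]; exact T.zero_mem⟩,
            Subtype.ext x.2⟩, rfl⟩⟩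
    rw [cls_of_simple_quotient hs hX, cls_of_simple_quotient hT hTf, ih hX hg,
      SimpleClass.mk_eq_mk (hT := hT) e, cls_congr k, add_assoc]

lemma cls_quotient_of_le {X Y : Submodule R N} (hXY : X ≤ Y) (h : IsFiniteLength R (N ⧸ X)) :
    cls R (N ⧸ X) = cls R (Y ⧸ X.comap Y.subtype) + cls R (N ⧸ Y) := by
  rw [cls_eq_ker_add h (f := X.mapQ Y LinearMap.id hXY) fun y => by
    obtain ⟨x, rfl⟩ := Y.mkQ_surjective y
    exact ⟨X.mkQ x, rfl⟩]
  congr 1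
  let g : Y →ₗ[R] LinearMap.ker (X.mapQ Y LinearMap.id hXY) :=
    (X.mkQ ∘ₗ Y.subtype).codRestrict _ fun y => (Submodule.Quotient.mk_eq_zero Y).mpr y.2
  have hg : Function.Surjective g := by
    rintro ⟨q, hq⟩
    obtain ⟨x, rfl⟩ := X.mkQ_surjective q
    exact ⟨⟨x, (Submodule.Quotient.mk_eq_zero Y).mp hq⟩, rfl⟩
  refine (cls_congr ((Submodule.quotEquivOfEq _ _ ?_).trans
    (g.quotKerEquivOfSurjective hg))).symm
  rw [show LinearMap.ker g = _ from LinearMap.ker_codRestrict _ _ _, LinearMap.ker_comp,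
    Submodule.ker_mkQ]

lemma isFiniteLength_subquotient {X Y : Submodule R N} (h : IsFiniteLength R (N ⧸ X)) :
    IsFiniteLength R (Y ⧸ X.comap Y.subtype) :=
  h.of_injective (f := (X.comap Y.subtype).mapQ X Y.subtype le_rfl) <| by
    rw [← LinearMap.ker_eq_bot, Submodule.mapQ, Submodule.ker_liftQ, LinearMap.ker_comp,
      Submodule.ker_mkQ, Submodule.mkQ_map_self]

lemma isFiniteLength_quotient_of_le {X Y : Submodule R N} (hXY : X ≤ Y)
    (h : IsFiniteLength R (N ⧸ X)) : IsFiniteLength R (N ⧸ Y) :=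
  h.of_surjective (f := X.mapQ Y LinearMap.id hXY) fun y => by
    obtain ⟨x, rfl⟩ := Y.mkQ_surjective y
    exact ⟨X.mkQ x, rfl⟩

lemma isFiniteLength_quotient_of_subquotient {X Y : Submodule R N} (hXY : X ≤ Y)
    (h : IsFiniteLength R (Y ⧸ X.comap Y.subtype)) (h' : IsFiniteLength R (N ⧸ Y)) :
    IsFiniteLength R (N ⧸ X) := by
  refine isFiniteLength_of_submodule_quotient (Y.map X.mkQ) ?_
    ((Submodule.quotientQuotientEquivQuotient X Y hXY).symm.isFiniteLength h')
  let g : Y →ₗ[R] Y.map X.mkQ := X.mkQ.restrict fun x hx => Submodule.mem_map_of_mem hx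
  have hg : Function.Surjective g := by
    rintro ⟨_, x, hx, rfl⟩
    exact ⟨⟨x, hx⟩, rfl⟩
  refine h.of_surjective (f := (X.comap Y.subtype).liftQ g ?_) ?_
  · intro x hx
    exact Subtype.ext ((Submodule.Quotient.mk_eq_zero X).mpr hx)
  · intro y
    obtain ⟨x, rfl⟩ := hg y
    exact ⟨(X.comap Y.subtype).mkQ x, rfl⟩

lemma cls_eq_zero_iff (h : IsFiniteLength R N) : cls R N = 0 ↔ Subsingleton N := by
  refine ⟨fun h0 => ?_, fun _ => cls_of_subsingleton⟩
  cases h with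
  | of_subsingleton => assumption
  | @of_simple_quotient _ _ _ X hX hXf =>
    rw [cls_of_simple_quotient hX hXf, add_eq_zero] at h0
    exact absurd h0.2 (by simp)

end Classes

/-! ### Finiteness over arithmetical rings, and the topology of the Dirichlet algebra -/

section Finiteness

variable {R : Type u} [Ring R]

lemma finite_linearMap {M N : Type*} [AddCommGroup M] [Module R M] [AddCommGroup N]
    [Module R N] [Module.Finite R M] [Finite N] : Finite (M →ₗ[R] N) := by
  obtain ⟨s, hs⟩ := Module.Finite.fg_top (R := R) (M := M)
  refine Finite.of_injective (fun (f : M →ₗ[R] N) (x : s) => f x) fun f g h => ?_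
  exact LinearMap.ext_on hs fun x hx => congrFun h ⟨x, hx⟩

lemma IsLeftArithmetical.two_le_card (hR : IsLeftArithmetical R) (s : SimpleClass R) :
    2 ≤ s.card := by
  induction s using SimpleClass.ind with
  | h S hS =>
    have := hR.finite_of_simple S hS
    have := IsSimpleModule.nontrivial R S
    exact Finite.one_lt_card

/-- A norm bound confines the support to the finitely many classes of cardinality at most `n`; as
cardinalities are at least `2`, it also bounds every exponent by `n`. -/
lemma IsLeftArithmetical.finite_norm_le (hR : IsLeftArithmetical R) (n : ℕ) :
    {g : G R | g.norm ≤ n}.Finite := by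
  have hT : {s : SimpleClass R | s.card ≤ n}.Finite := by
    refine ((Set.finite_Icc 1 n).biUnion fun m (hm : m ∈ Set.Icc 1 n) =>
      hR.finite_classes m hm.1).subset fun s hs => ?_
    exact Set.mem_biUnion (x := s.card) ⟨one_le_two.trans (hR.two_le_card s), hs⟩ rfl
  classical
  refine (Set.finite_Iic (Finsupp.indicator hT.toFinset fun _ _ => n)).subset fun g hg s => ?_
  by_cases hs : g s = 0
  · simp [hs]
  have h1 : s.card ^ g s ≤ n := by
    refine le_trans ?_ hg
    exact Finset.single_le_prod' (f := fun s => s.card ^ g s)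
      (fun t _ => Nat.one_le_pow _ _ (zero_lt_two.trans_le (hR.two_le_card t)))
      (Finsupp.mem_support_iff.mpr hs)
  have h2 : s ∈ hT.toFinset := hT.mem_toFinset.mpr ((Nat.le_self_pow hs _).trans h1)
  rw [Finsupp.indicator_of_mem h2]
  exact (Nat.lt_pow_self (hR.two_le_card s)).le.trans h1

lemma exists_isCoatom_ge {N : Type u} [AddCommGroup N] [Module R N] {X : Submodule R N}
    (h : IsFiniteLength R (N ⧸ X)) (hX : X ≠ ⊤) : ∃ Y, IsCoatom Y ∧ X ≤ Y := by
  cases h with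
  | of_subsingleton => exact absurd (Submodule.Quotient.subsingleton_iff.mp ‹_›) hX
  | @of_simple_quotient _ _ _ T hT hTf =>
    refine ⟨T.comap X.mkQ, ?_, ?_⟩
    · rw [← isSimpleModule_iff_isCoatom]
      refine IsSimpleModule.congr ((Submodule.quotEquivOfEq _ _
        (by rw [LinearMap.ker_comp, Submodule.ker_mkQ])).trans
        ((T.mkQ ∘ₗ X.mkQ).quotKerEquivOfSurjective (T.mkQ_surjective.comp X.mkQ_surjective)))
    · intro x hx
      rw [Submodule.mem_comap, Submodule.mkQ_apply, (Submodule.Quotient.mk_eq_zero X).mpr hx]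
      exact T.zero_mem

/-- Induction on the length of the quotient. A proper `X` lies in a maximal `Y`, the kernel of a map
to a simple module in the support of `g`; there are finitely many such maps because simple modules
are finite. Finite presentation of simple modules makes `Y` finitely generated, so the induction
applies to `X` inside `Y`. -/
lemma IsLeftArithmetical.finite_submodules (hR : IsLeftArithmetical R) (g : G R) (N : Type u)
    [AddCommGroup N] [Module R N] [Module.Finite R N] :
    {X : Submodule R N | IsFiniteLength R (N ⧸ X) ∧ cls R (N ⧸ X) = g}.Finite := by
  classical
  induction hd : g.degree generalizing g N with
  | zero =>
    refine (Set.finite_singleton ⊤).subset fun X ⟨hX, hg⟩ => ?_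
    rw [(Finsupp.degree_eq_zero_iff g).mp hd, cls_eq_zero_iff hX] at hg
    exact Submodule.Quotient.subsingleton_iff.mp hg
  | succ d ih =>
    let C (s : SimpleClass R) : Set (Submodule R N) :=
      {Y | ∃ h : IsSimpleModule R (N ⧸ Y), SimpleClass.mk (N ⧸ Y) h = s}
    have hC : ∀ s, (C s).Finite := fun s => by
      induction s using SimpleClass.ind with
      | h S hS =>
        have := hR.finite_of_simple S hS
        have : Finite (N →ₗ[R] S) := finite_linearMap
        refine (Set.finite_range fun f : N →ₗ[R] S => LinearMap.ker f).subset fun Y ⟨h, hY⟩ => ?_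
        obtain ⟨e⟩ := SimpleClass.nonempty_equiv_of_mk_eq hY
        exact ⟨e.toLinearMap ∘ₗ Y.mkQ, (LinearEquiv.ker_comp _ _).trans Y.ker_mkQ⟩
    -- Allowing every class of degree `d` below `g` avoids subtracting the class of `N ⧸ Y` from
    -- `g`.
    let D (Y : Submodule R N) : Set (Submodule R Y) :=
      {X | IsFiniteLength R (Y ⧸ X) ∧ (cls R (Y ⧸ X)).degree = d ∧ cls R (Y ⧸ X) ≤ g}
    have hD : ∀ s, ∀ Y ∈ C s, (D Y).Finite := by
      rintro s Y ⟨hY, -⟩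
      have := hR.finitePresentation_of_simple _ hY
      have hfg : Y.FG := by
        simpa using Module.FinitePresentation.fg_ker Y.mkQ Y.mkQ_surjective
      have : Module.Finite R Y := Module.Finite.iff_fg.mpr hfg
      have : {a : G R | a.degree = d ∧ a ≤ g}.Finite := (Set.finite_Iic g).subset fun a h => h.2
      refine (this.biUnion fun a ha => ih a Y ha.1).subset fun X hX => ?_
      exact Set.mem_biUnion hX.2 ⟨hX.1, rfl⟩
    refine (g.support.finite_toSet.biUnion fun s _ => (hC s).biUnion fun Y hY =>
      (hD s Y hY).image (Submodule.map Y.subtype)).subset fun X ⟨hX, hg⟩ => ?_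
    have hne : X ≠ ⊤ := by
      rintro rfl
      rw [cls_of_subsingleton] at hg
      rw [← hg, map_zero] at hd
      omega
    obtain ⟨Y, hY, hXY⟩ := exists_isCoatom_ge hX hne
    have hs := isSimpleModule_iff_isCoatom.mpr hY
    have hcls := cls_quotient_of_le hXY hX
    rw [hg, cls_simple hs] at hcls
    refine Set.mem_biUnion (x := SimpleClass.mk _ hs) ?_ (Set.mem_biUnion (x := Y) ⟨hs, rfl⟩
      ⟨X.comap Y.subtype, ⟨isFiniteLength_subquotient hX, ?_, ?_⟩, ?_⟩)
    · simp [hcls]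
    · have := congrArg Finsupp.degree hcls
      rw [map_add, Finsupp.degree_single, hd] at this
      omega
    · rw [hcls]; exact le_self_add
    · rw [Submodule.map_comap_subtype, inf_eq_right.mpr hXY]

end Finiteness

/-! ### Coefficientwise convergence in the Dirichlet algebra. -/

section Topology

open Filter Topology

variable {R : Type u} [Ring R]

/-- The coefficient at `g` is constant on balls of radius `g.norm`; conversely a ball imposes only
finitely many coefficient conditions, by `finite_norm_le`. -/
lemma IsLeftArithmetical.topology_eq (hR : IsLeftArithmetical R) :
    Dir.instTopologicalSpace R =
      @MvPowerSeries.WithPiTopology.instTopologicalSpace (SimpleClass R) ℂ ⊥ := by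
  let _ : TopologicalSpace ℂ := ⊥
  have : DiscreteTopology ℂ := ⟨rfl⟩
  refine le_antisymm ?_ ?_
  · refine le_iInf fun g => ?_
    refine continuous_iff_le_induced.mp
      (?_ : @Continuous (Dir R) ℂ (Dir.instTopologicalSpace R) ⊥ fun f => f g)
    refine continuous_discrete_rng.mpr fun b => ?_
    rw [isOpen_iff_mem_nhds]
    intro f hf
    refine mem_of_superset (IsOpen.mem_nhds (TopologicalSpace.isOpen_generateFrom_of_mem
      ⟨f, G.norm g, rfl⟩) fun _ _ => rfl) fun h hh => ?_
    exact (hh g le_rfl).trans hf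
  · refine le_generateFrom ?_
    rintro _ ⟨f, n, rfl⟩
    have : {h : Dir R | ∀ g : G R, g.norm ≤ n →
        MvPowerSeries.coeff g h = MvPowerSeries.coeff g f} =
        ⋂ g ∈ {g : G R | g.norm ≤ n}, MvPowerSeries.coeff g ⁻¹' {MvPowerSeries.coeff g f} := by
      ext; simp
    rw [this]
    exact @Set.Finite.isOpen_biInter _ _ (MvPowerSeries.WithPiTopology.instTopologicalSpace ℂ)
      _ _ (hR.finite_norm_le n) fun g _ => @IsOpen.preimage _ _
        (MvPowerSeries.WithPiTopology.instTopologicalSpace ℂ) _ _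
        (MvPowerSeries.WithPiTopology.continuous_coeff ℂ g) _ (isOpen_discrete _)

lemma IsLeftArithmetical.isTopologicalRing (hR : IsLeftArithmetical R) :
    IsTopologicalRing (Dir R) := by
  let _ : TopologicalSpace ℂ := ⊥
  have : DiscreteTopology ℂ := ⟨rfl⟩
  rw [hR.topology_eq]
  exact MvPowerSeries.WithPiTopology.instIsTopologicalRing _ _

lemma IsLeftArithmetical.t3Space (hR : IsLeftArithmetical R) : T3Space (Dir R) := by
  let _ : TopologicalSpace ℂ := ⊥
  have : DiscreteTopology ℂ := ⟨rfl⟩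
  rw [hR.topology_eq]
  exact inferInstanceAs (T3Space ((SimpleClass R →₀ ℕ) → ℂ))

lemma IsLeftArithmetical.tendsto_iff (hR : IsLeftArithmetical R) {ι : Type*} {f : ι → Dir R}
    {l : Filter ι} {a : Dir R} : Tendsto f l (𝓝 a) ↔
      ∀ g, ∀ᶠ i in l, MvPowerSeries.coeff g (f i) = MvPowerSeries.coeff g a := by
  let _ : TopologicalSpace ℂ := ⊥
  have : DiscreteTopology ℂ := ⟨rfl⟩
  rw [hR.topology_eq, MvPowerSeries.WithPiTopology.tendsto_iff_coeff_tendsto]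
  simp only [nhds_discrete, tendsto_pure]

/-- A family of which only finitely many members contribute to each coefficient is summable. -/
lemma IsLeftArithmetical.summable (hR : IsLeftArithmetical R) {ι : Type*} {f : ι → Dir R}
    (h : ∀ g, {i | MvPowerSeries.coeff g (f i) ≠ 0}.Finite) : Summable f := by
  let _ : TopologicalSpace ℂ := ⊥
  rw [hR.topology_eq, MvPowerSeries.WithPiTopology.summable_iff_summable_coeff]
  exact fun g => summable_of_hasFiniteSupport (h g)

lemma IsLeftArithmetical.coeff_tsum (hR : IsLeftArithmetical R) {ι : Type*} {f : ι → Dir R}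
    (hf : Summable f) {g : G R} {s : Finset ι}
    (h : ∀ i ∉ s, MvPowerSeries.coeff g (f i) = 0) :
    MvPowerSeries.coeff g (∑' i, f i) = ∑ i ∈ s, MvPowerSeries.coeff g (f i) := by
  classical
  obtain ⟨t, ht⟩ := (eventually_atTop.mp (hR.tendsto_iff.mp hf.hasSum g))
  rw [← ht (t ∪ s) Finset.subset_union_left, map_sum]
  exact (Finset.sum_subset Finset.subset_union_right fun i _ hi => h i hi).symm

end Topology

/-! ### The number of homomorphisms out of a projective module -/

section HomCard

variable {R : Type u} [Ring R] (M : Type u) [AddCommGroup M] [Module R M]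

/-- The number of homomorphisms from `M` to a simple module of the given class. -/
def SimpleClass.homCard (s : SimpleClass R) : ℕ :=
  Quotient.lift (s := simpleSetoid R) (fun S => Nat.card (M →ₗ[R] S.1))
    (fun _ _ ⟨e⟩ => Nat.card_congr ⟨fun f => e.toLinearMap ∘ₗ f, fun f => e.symm.toLinearMap ∘ₗ f,
      fun f => by ext; simp, fun f => by ext; simp⟩) s

/-- The multiplicative extension to `G` of the number of homomorphisms from `M`. -/
def homCard (g : G R) : ℂ := g.prod fun s n => (s.homCard M : ℂ) ^ n

@[simp] lemma homCard_zero : homCard M (0 : G R) = 1 := Finsupp.prod_zero_index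

lemma homCard_add (g g' : G R) : homCard M (g + g') = homCard M g * homCard M g' :=
  Finsupp.prod_add_index' (fun _ => pow_zero _) fun _ _ _ => pow_add _ _ _

lemma homCard_single (s : SimpleClass R) :
    homCard M (Finsupp.single s 1) = s.homCard M := by
  simp [homCard, Finsupp.prod_single_index]

variable {M}

/-- This permits dividing by `homCard` in the weights. -/
lemma homCard_ne_zero (hR : IsLeftArithmetical R) [Module.Finite R M] (g : G R) :
    homCard M g ≠ 0 := by
  refine Finset.prod_ne_zero_iff.mpr fun s _ => pow_ne_zero _ ?_
  induction s using SimpleClass.ind with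
  | h S hS =>
    have := hR.finite_of_simple S hS
    have : Finite (M →ₗ[R] S) := finite_linearMap
    exact Nat.cast_ne_zero.mpr (Nat.card_pos (α := M →ₗ[R] S)).ne'

/-- Projectivity makes `Hom(M, -)` exact, and the count is Lagrange's theorem for the kernel of
composition with the quotient map. -/
lemma card_linearMap_eq_mul [Module.Projective R M] {N : Type u} [AddCommGroup N] [Module R N]
    (X : Submodule R N) :
    Nat.card (M →ₗ[R] N) = Nat.card (M →ₗ[R] X) * Nat.card (M →ₗ[R] N ⧸ X) := by
  let φ : (M →ₗ[R] N) →+ (M →ₗ[R] N ⧸ X) :=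
    AddMonoidHom.mk' (fun f => X.mkQ ∘ₗ f) fun f g => LinearMap.comp_add _ _ _
  have hφ : Function.Surjective φ := fun f =>
    Module.projective_lifting_property X.mkQ f X.mkQ_surjective
  have hk : ∀ f : φ.ker, ∀ m, f.1 m ∈ X := fun f m =>
    (Submodule.Quotient.mk_eq_zero X).mp (LinearMap.congr_fun f.2 m)
  let e : φ.ker ≃ (M →ₗ[R] X) :=
    { toFun := fun f => f.1.codRestrict X (hk f)
      invFun := fun f => ⟨X.subtype ∘ₗ f, LinearMap.ext fun m =>
        (Submodule.Quotient.mk_eq_zero X).mpr (f m).2⟩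
      left_inv := fun f => rfl
      right_inv := fun f => rfl }
  rw [AddSubgroup.card_eq_card_quotient_mul_card_addSubgroup φ.ker,
    Nat.card_congr (QuotientAddGroup.quotientKerEquivOfSurjective φ hφ).toEquiv,
    Nat.card_congr e, mul_comm]

/-- For projective `M` the number of homomorphisms is multiplicative in extensions, hence a function
of the class. This is why the brackets descend to `G`. -/
lemma homCard_cls [Module.Projective R M] {N : Type u} [AddCommGroup N] [Module R N]
    (h : IsFiniteLength R N) : homCard M (cls R N) = Nat.card (M →ₗ[R] N) := by
  induction h with
  | @of_subsingleton N _ _ _ =>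
    rw [cls_of_subsingleton, homCard_zero, Nat.card_unique, Nat.cast_one]
  | @of_simple_quotient N _ _ X hX hXf ih =>
    rw [cls_of_simple_quotient hX hXf, homCard_add, ih, homCard_single, card_linearMap_eq_mul X,
      Nat.cast_mul]
    rfl

/-- Homomorphisms from `M/IM` to a module annihilated by `I`. -/
def homModIEquiv (I : Ideal R) {N : Type u} [AddCommGroup N] [Module R N]
    (h : ∀ a ∈ I, ∀ n : N, a • n = 0) : (ModI I M →ₗ[R] N) ≃ (M →ₗ[R] N) where
  toFun f := f ∘ₗ (I • (⊤ : Submodule R M)).mkQ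
  invFun f := (I • (⊤ : Submodule R M)).liftQ f (Submodule.smul_le.mpr fun a ha m _ => by
    rw [LinearMap.mem_ker, map_smul, h a ha])
  left_inv f := by ext; rfl
  right_inv f := by ext; rfl

end HomCard

/-! ### The functor `I ⊗ -` for an invertible ideal -/

section TensorFacts

variable {R : Type u} [Ring R] (I : Ideal R) [I.IsTwoSided]
variable {N N' : Type u} [AddCommGroup N] [Module R N] [AddCommGroup N'] [Module R N']

/-- The pure tensors of `I ⊗_R N`. -/
def tmk (x : I) (n : N) : Tensor I N := (tensorRel I N).mkQ (x ⊗ₜ[ℤ] n)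

lemma tmk_add_left (x y : I) (n : N) : tmk I (x + y) n = tmk I x n + tmk I y n := by
  rw [tmk, TensorProduct.add_tmul, map_add]; rfl

lemma tmk_add_right (x : I) (n n' : N) : tmk I x (n + n') = tmk I x n + tmk I x n' := by
  rw [tmk, TensorProduct.tmul_add, map_add]; rfl

lemma smul_tmk (r : R) (x : I) (n : N) : r • tmk I x n = tmk I (r • x) n := rfl

lemma tmk_mul (x : I) (r : R) (n : N) :
    tmk I ⟨(x : R) * r, I.mul_mem_right r x.2⟩ n = tmk I x (r • n) :=
  (Submodule.Quotient.eq _).mpr (Submodule.subset_span ⟨x, r, n, rfl⟩)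

lemma tensorMap_tmk (f : N →ₗ[R] N') (x : I) (n : N) :
    tensorMap I f (tmk I x n) = tmk I x (f n) := rfl

variable {I} in
@[elab_as_elim]
lemma tensor_induction {p : Tensor I N → Prop} (h0 : p 0) (h : ∀ x n, p (tmk I x n))
    (hadd : ∀ a b, p a → p b → p (a + b)) (t : Tensor I N) : p t := by
  obtain ⟨t, rfl⟩ := (tensorRel I N).mkQ_surjective t
  induction t with
  | zero => simpa using h0
  | tmul x n => exact h x n
  | add a b ha hb => rw [map_add]; exact hadd _ _ ha hb

/-- The universal property of `I ⊗_R N`. -/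
def tensorLift {P : Type u} [AddCommGroup P] [Module R P] (f : I →ₗ[R] N →+ P)
    (hf : ∀ (x : I) (r : R) (n : N), f ⟨(x : R) * r, I.mul_mem_right r x.2⟩ n = f x (r • n)) :
    Tensor I N →ₗ[R] P :=
  (tensorRel I N).liftQ (TensorProduct.AlgebraTensorModule.lift
    { toFun := fun x => (f x).toIntLinearMap
      map_add' := fun x y => by ext; simp
      map_smul' := fun r x => by ext; simp })
    (Submodule.span_le.mpr (by
      rintro _ ⟨x, r, n, rfl⟩
      simpa [sub_eq_zero] using hf x r n))

variable (N) in
/-- The multiplication map `I ⊗_R N → N`. -/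
def tensorMul : Tensor I N →ₗ[R] N :=
  tensorLift I
    { toFun := fun x => DistribSMul.toAddMonoidHom N (x : R)
      map_add' := fun x y => by ext; simp [add_smul]
      map_smul' := fun r x => by ext; simp [mul_smul] }
    fun x r n => by simp [mul_smul]

lemma tensorMul_tmk (x : I) (n : N) : tensorMul I N (tmk I x n) = (x : R) • n := rfl

lemma tensorMul_natural (f : N →ₗ[R] N') (t : Tensor I N) :
    tensorMul I N' (tensorMap I f t) = f (tensorMul I N t) := by
  induction t using tensor_induction with
  | h0 => simp
  | h x n => rw [tensorMap_tmk, tensorMul_tmk, tensorMul_tmk, map_smul]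
  | hadd a b ha hb => simp only [map_add, ha, hb]

lemma range_tensorMul : LinearMap.range (tensorMul I N) = I • (⊤ : Submodule R N) := by
  refine le_antisymm ?_ (Submodule.smul_le.mpr fun a ha n _ => ⟨tmk I ⟨a, ha⟩ n, rfl⟩)
  rintro _ ⟨t, rfl⟩
  induction t using tensor_induction with
  | h0 => simp
  | h x n => exact Submodule.smul_mem_smul x.2 trivial
  | hadd a b ha hb => rw [map_add]; exact add_mem ha hb

/-- Flatness of a finite projective module, by hand: a dual basis recovers a tensor from its
product. -/
lemma tensorMul_injective [Module.Finite R N] [Module.Projective R N] :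
    Function.Injective (tensorMul I N) := by
  obtain ⟨n, f, g, -, -, hfg⟩ := Module.Finite.exists_comp_eq_id_of_projective R N
  have hI : ∀ t i, g (tensorMul I N t) i ∈ I := fun t i => by
    induction t using tensor_induction with
    | h0 => simp
    | h x n => rw [tensorMul_tmk, map_smul]; exact I.mul_mem_right _ x.2
    | hadd a b ha hb => simpa using add_mem ha hb
  -- The maps `g` and `f` present `N` as a retract of a free module. The coordinates of the product
  -- of `t` lie in `I`, and they are the coefficients of `t` on the generators `f (Pi.single i 1)`.
  have key : ∀ t, t = ∑ i, tmk I ⟨g (tensorMul I N t) i, hI t i⟩ (f (Pi.single i 1)) := by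
    intro t
    induction t using tensor_induction with
    | h0 =>
      refine (Finset.sum_eq_zero fun i _ => ?_).symm
      have : (⟨g (tensorMul I N 0) i, hI 0 i⟩ : I) = 0 := Subtype.ext (by simp)
      rw [this, tmk, TensorProduct.zero_tmul, map_zero]
    | h x m =>
      have h1 : ∀ i, tmk I ⟨g (tensorMul I N (tmk I x m)) i, hI _ i⟩ (f (Pi.single i 1)) =
          tmk I x (g m i • f (Pi.single i 1)) := fun i => by
        rw [← tmk_mul]
        congr 1
        exact Subtype.ext (by simp [tensorMul_tmk])
      simp only [h1]
      have h2 : m = ∑ i, g m i • f (Pi.single i 1) := by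
        conv_lhs => rw [← LinearMap.id_apply (R := R) m, ← hfg, LinearMap.comp_apply]
        rw [LinearMap.pi_apply_eq_sum_univ f (g m)]
        refine Finset.sum_congr rfl fun i _ => congrArg (fun v => g m i • f v) ?_
        ext j
        simp [Pi.single_apply, eq_comm]
      conv_lhs => rw [h2]
      exact map_sum (AddMonoidHom.mk' (tmk I x) (tmk_add_right I x)) _ _
    | hadd a b ha hb =>
      conv_lhs => rw [ha, hb, ← Finset.sum_add_distrib]
      refine Finset.sum_congr rfl fun i _ => ?_
      rw [← tmk_add_left]
      congr 1
      exact Subtype.ext (by simp)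
  rw [injective_iff_map_eq_zero]
  intro t ht
  rw [key t]
  refine Finset.sum_eq_zero fun i _ => ?_
  have : (⟨g (tensorMul I N t) i, hI t i⟩ : I) = 0 := Subtype.ext (by simp [ht])
  rw [this, tmk, TensorProduct.zero_tmul, map_zero]

lemma tensorMap_id : tensorMap I (LinearMap.id : N →ₗ[R] N) = LinearMap.id :=
  tensor_hom_ext I fun _ _ => rfl

lemma tensorMap_comp {N'' : Type u} [AddCommGroup N''] [Module R N''] (g : N' →ₗ[R] N'')
    (f : N →ₗ[R] N') : tensorMap I (g ∘ₗ f) = tensorMap I g ∘ₗ tensorMap I f :=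
  tensor_hom_ext I fun _ _ => rfl

/-- An isomorphism `N ≃ N'` induces `I ⊗ N ≃ I ⊗ N'`. -/
def tensorCongr (e : N ≃ₗ[R] N') : Tensor I N ≃ₗ[R] Tensor I N' :=
  LinearEquiv.ofLinearMap (tensorMap I e.toLinearMap) (tensorMap I e.symm.toLinearMap)
    (by rw [← tensorMap_comp, LinearEquiv.comp_symm, tensorMap_id])
    (by rw [← tensorMap_comp, LinearEquiv.symm_comp, tensorMap_id])

lemma tensorMap_surjective {f : N →ₗ[R] N'} (hf : Function.Surjective f) :
    Function.Surjective (tensorMap I f) := fun t => by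
  induction t using tensor_induction with
  | h0 => exact ⟨0, map_zero _⟩
  | h x n => obtain ⟨m, rfl⟩ := hf n; exact ⟨tmk I x m, rfl⟩
  | hadd a b ha hb =>
    obtain ⟨a, rfl⟩ := ha; obtain ⟨b, rfl⟩ := hb; exact ⟨a + b, map_add _ _ _⟩

/-- If `I N = 0` and `I J ≤ J I`, then `I (J ⊗ N) = 0`. -/
lemma smul_tensor_eq_zero {I J : Ideal R} [J.IsTwoSided] (hIJ : I * J ≤ J * I)
    (h : ∀ a ∈ I, ∀ n : N, a • n = 0) (a : R) (ha : a ∈ I) (t : Tensor J N) : a • t = 0 := by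
  induction t using tensor_induction with
  | h0 => simp
  | h x n =>
    rw [smul_tmk]
    have hx : a * (x : R) ∈ J * I := hIJ (Ideal.mul_mem_mul ha x.2)
    have : ∀ z (hz : z ∈ J * I), ∃ hz' : z ∈ J, tmk J ⟨z, hz'⟩ n = 0 := by
      intro z hz
      induction hz using Submodule.mul_induction_on' with
      | mem_mul_mem y hy b hb =>
        refine ⟨J.mul_mem_right b hy, ?_⟩
        rw [tmk_mul J ⟨y, hy⟩, h b hb, tmk, TensorProduct.tmul_zero, map_zero]
      | add y hy z hz ihy ihz =>
        obtain ⟨hy', ey⟩ := ihy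
        obtain ⟨hz', ez⟩ := ihz
        exact ⟨add_mem hy' hz', (tmk_add_left J ⟨y, hy'⟩ ⟨z, hz'⟩ n).trans (by rw [ey, ez, add_zero])⟩
    exact (this _ hx).2
  | hadd a b ha hb => rw [smul_add, ha, hb, add_zero]

end TensorFacts

section Invertible

open CategoryTheory

variable {R : Type u} [Ring R] {I : Ideal R} [I.IsTwoSided]
variable {N N' : Type u} [AddCommGroup N] [Module R N] [AddCommGroup N'] [Module R N']

namespace IsInvertibleIdeal

variable (hI : IsInvertibleIdeal I)

include hI

lemma tensorMap_injective {f : N →ₗ[R] N'} (hf : Function.Injective f) :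
    Function.Injective (tensorMap I f) := by
  have : (tensorFunctor I).IsEquivalence := hI
  have : Mono (ModuleCat.ofHom f) := (ModuleCat.mono_iff_injective _).mpr hf
  exact (ModuleCat.mono_iff_injective ((tensorFunctor I).map (ModuleCat.ofHom f))).mp inferInstance

lemma exists_tensorMap_eq (f : Tensor I N →ₗ[R] Tensor I N') :
    ∃ g : N →ₗ[R] N', tensorMap I g = f := by
  have : (tensorFunctor I).IsEquivalence := hI
  obtain ⟨g, hg⟩ := (tensorFunctor I).map_surjective (X := ModuleCat.of R N)
    (Y := ModuleCat.of R N') (ModuleCat.ofHom f)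
  exact ⟨g.hom, congrArg ModuleCat.Hom.hom hg⟩

lemma tensorMap_inj {f g : N →ₗ[R] N'} (h : tensorMap I f = tensorMap I g) : f = g := by
  have : (tensorFunctor I).IsEquivalence := hI
  have := (tensorFunctor I).map_injective (X := ModuleCat.of R N)
    (Y := ModuleCat.of R N') (a₁ := ModuleCat.ofHom f) (a₂ := ModuleCat.ofHom g)
    (congrArg ModuleCat.ofHom h)
  exact congrArg ModuleCat.Hom.hom this

lemma exists_tensor_equiv (T : Type u) [AddCommGroup T] [Module R T] :
    ∃ N : ModuleCat.{u} R, Nonempty (Tensor I N ≃ₗ[R] T) := by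
  have : (tensorFunctor I).IsEquivalence := hI
  obtain ⟨N, ⟨e⟩⟩ := Functor.EssSurj.mem_essImage (F := tensorFunctor I) (ModuleCat.of R T)
  exact ⟨N, ⟨e.toLinearEquiv⟩⟩

lemma nonempty_equiv_of_tensor (e : Tensor I N ≃ₗ[R] Tensor I N') : Nonempty (N ≃ₗ[R] N') := by
  obtain ⟨f, hf⟩ := hI.exists_tensorMap_eq e.toLinearMap
  obtain ⟨g, hg⟩ := hI.exists_tensorMap_eq e.symm.toLinearMap
  refine ⟨LinearEquiv.ofLinearMap f g (hI.tensorMap_inj ?_) (hI.tensorMap_inj ?_)⟩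
  · rw [tensorMap_comp, hf, hg, LinearEquiv.comp_symm, tensorMap_id]
  · rw [tensorMap_comp, hf, hg, LinearEquiv.symm_comp, tensorMap_id]

lemma subsingleton_of_tensor [Subsingleton (Tensor I N)] : Subsingleton N := by
  have : (LinearMap.id : N →ₗ[R] N) = 0 := hI.tensorMap_inj (Subsingleton.elim _ _)
  exact ⟨fun x y => (LinearMap.congr_fun this x).trans (LinearMap.congr_fun this y).symm⟩

/-- An additive equivalence is exact. -/
lemma range_tensorMap_subtype (X : Submodule R N) :
    LinearMap.range (tensorMap I X.subtype) = LinearMap.ker (tensorMap I X.mkQ) := by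
  have : (tensorFunctor I).IsEquivalence := hI
  have : (tensorFunctor I).Additive := ⟨fun {A B f g} => ModuleCat.hom_ext
    (tensor_hom_ext I fun x n => tmk_add_right I x (f.hom n) (g.hom n))⟩
  let S : ShortComplex (ModuleCat.{u} R) := ShortComplex.mk (ModuleCat.ofHom X.subtype)
    (ModuleCat.ofHom X.mkQ) (by ext; simp)
  have hS : S.Exact := (ShortComplex.moduleCat_exact_iff_range_eq_ker S).mpr (by simp [S])
  exact (ShortComplex.moduleCat_exact_iff_range_eq_ker _).mp (hS.map (tensorFunctor I))

/-- `(I ⊗ N) / (I ⊗ X) ≃ I ⊗ (N / X)`. -/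
def tensorQuotientEquiv (X : Submodule R N) :
    (Tensor I N ⧸ LinearMap.range (tensorMap I X.subtype)) ≃ₗ[R] Tensor I (N ⧸ X) :=
  (Submodule.quotEquivOfEq _ _ (hI.range_tensorMap_subtype X)).trans
    ((tensorMap I X.mkQ).quotKerEquivOfSurjective (tensorMap_surjective I X.mkQ_surjective))

/-- Essential surjectivity and fullness turn the inclusion of `T` into `I ⊗ g` for some map `g`; the
range of `g` is the required submodule. With `range_tensorMap_le_iff`, the submodule lattices of `N`
and `I ⊗ N` are identified. -/
lemma exists_range_tensorMap_eq (T : Submodule R (Tensor I N)) :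
    ∃ X : Submodule R N, LinearMap.range (tensorMap I X.subtype) = T := by
  obtain ⟨N₀, ⟨e⟩⟩ := hI.exists_tensor_equiv T
  obtain ⟨g, hg⟩ := hI.exists_tensorMap_eq (N' := N) (T.subtype ∘ₗ e.toLinearMap)
  refine ⟨LinearMap.range g, ?_⟩
  have h1 : LinearMap.range (tensorMap I g) = T := by
    rw [hg, LinearMap.range_comp, LinearEquiv.range, Submodule.map_top, Submodule.range_subtype]
  rw [← h1, show g = (LinearMap.range g).subtype ∘ₗ g.rangeRestrict from rfl]
  conv_rhs => rw [tensorMap_comp, LinearMap.range_comp,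
    LinearMap.range_eq_top.mpr (tensorMap_surjective I g.surjective_rangeRestrict),
    Submodule.map_top]
  rfl

lemma range_tensorMap_le_iff {X Y : Submodule R N} :
    LinearMap.range (tensorMap I X.subtype) ≤ LinearMap.range (tensorMap I Y.subtype) ↔ X ≤ Y := by
  constructor
  · intro h
    have h1 : tensorMap I (Y.mkQ ∘ₗ X.subtype) = 0 := by
      rw [tensorMap_comp]
      refine LinearMap.ext fun t => ?_
      have := h ⟨t, rfl⟩
      rw [hI.range_tensorMap_subtype] at this
      exact this
    have h2 : Y.mkQ ∘ₗ X.subtype = 0 :=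
      hI.tensorMap_inj (h1.trans (tensor_hom_ext I fun x n => by
        change 0 = tmk I x 0
        rw [tmk, TensorProduct.tmul_zero, map_zero]))
    intro x hx
    exact (Submodule.Quotient.mk_eq_zero Y).mp (LinearMap.congr_fun h2 ⟨x, hx⟩)
  · intro h
    rw [show X.subtype = Y.subtype ∘ₗ Submodule.inclusion h from rfl, tensorMap_comp]
    exact LinearMap.range_comp_le_range _ _

lemma isSimpleModule_tensor (h : IsSimpleModule R N) : IsSimpleModule R (Tensor I N) := by
  have hN := IsSimpleModule.nontrivial R N
  have : Nontrivial (Tensor I N) := by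
    by_contra hn
    rw [not_nontrivial_iff_subsingleton] at hn
    exact not_subsingleton N hI.subsingleton_of_tensor
  refine { eq_bot_or_eq_top := fun T => ?_ }
  obtain ⟨X, rfl⟩ := hI.exists_range_tensorMap_eq T
  rcases eq_bot_or_eq_top X with rfl | rfl
  · left
    refine (LinearMap.range_eq_bot).mpr (tensor_hom_ext I fun x n => ?_)
    change tmk I x ((⊥ : Submodule R N).subtype n) = 0
    rw [Subsingleton.elim n 0, map_zero, tmk, TensorProduct.tmul_zero, map_zero]
  · right
    exact LinearMap.range_eq_top.mpr (tensorMap_surjective I fun n => ⟨⟨n, trivial⟩, rfl⟩)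

omit hI in
/-- The permutation of the simple classes induced by `I ⊗ -`. -/
def shift (hI : IsInvertibleIdeal I) : SimpleClass R → SimpleClass R :=
  Quotient.map' (s₁ := simpleSetoid R) (s₂ := simpleSetoid R)
    (fun S => ⟨ModuleCat.of R (Tensor I S.1), hI.isSimpleModule_tensor S.2⟩)
    fun _ _ ⟨e⟩ => ⟨tensorCongr I e⟩

lemma shift_mk {S : Type u} [AddCommGroup S] [Module R S] (hS : IsSimpleModule R S) :
    hI.shift (SimpleClass.mk S hS) =
      SimpleClass.mk (Tensor I S) (hI.isSimpleModule_tensor hS) := rfl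

lemma shift_injective : Function.Injective hI.shift := by
  intro s t h
  induction s using SimpleClass.ind with
  | h S hS =>
    induction t using SimpleClass.ind with
    | h T hT =>
      obtain ⟨e⟩ := SimpleClass.nonempty_equiv_of_mk_eq h
      obtain ⟨e'⟩ := hI.nonempty_equiv_of_tensor e
      exact SimpleClass.mk_eq_mk e'

omit hI in
/-- The class of `I ⊗ N`, as a function of the class of `N`. -/
def shiftG (hI : IsInvertibleIdeal I) : G R →+ G R := Finsupp.mapDomain.addMonoidHom hI.shift

lemma shiftG_injective : Function.Injective hI.shiftG :=
  Finsupp.mapDomain_injective hI.shift_injective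

lemma shiftG_single (s : SimpleClass R) (n : ℕ) :
    hI.shiftG (Finsupp.single s n) = Finsupp.single (hI.shift s) n := Finsupp.mapDomain_single

/-- The degree is the length, and `I ⊗ -` only relabels composition factors. Lengths control
convergence later precisely because they survive the shift. -/
lemma degree_shiftG (g : G R) : (hI.shiftG g).degree = g.degree := by
  induction g using Finsupp.induction_linear with
  | zero => simp
  | add f g hf hg => rw [map_add, map_add, map_add, hf, hg]
  | single s n => rw [shiftG_single, Finsupp.degree_single, Finsupp.degree_single]

/-- `I ⊗ X` is isomorphic to its image in `I ⊗ N`. -/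
def tensorSubmoduleEquiv (X : Submodule R N) :
    Tensor I X ≃ₗ[R] LinearMap.range (tensorMap I X.subtype) :=
  LinearEquiv.ofInjective _ (hI.tensorMap_injective X.injective_subtype)

lemma isFiniteLength_cls_tensor (h : IsFiniteLength R N) :
    IsFiniteLength R (Tensor I N) ∧ cls R (Tensor I N) = hI.shiftG (cls R N) := by
  induction h with
  | @of_subsingleton N _ _ _ =>
    have : Subsingleton (Tensor I N) := by
      refine ⟨fun a b => ?_⟩
      have : ∀ t : Tensor I N, t = 0 := fun t => by
        induction t using tensor_induction with
        | h0 => rfl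
        | h x n => rw [Subsingleton.elim n 0, tmk, TensorProduct.tmul_zero, map_zero]
        | hadd a b ha hb => rw [ha, hb, add_zero]
      rw [this a, this b]
    exact ⟨.of_subsingleton, by rw [cls_of_subsingleton, cls_of_subsingleton, map_zero]⟩
  | @of_simple_quotient N _ _ X hX hXf ih =>
    have e := hI.tensorSubmoduleEquiv X
    have hf := e.isFiniteLength ih.1
    have hs : IsSimpleModule R (Tensor I N ⧸ LinearMap.range (tensorMap I X.subtype)) :=
      (hI.isSimpleModule_tensor hX).congr (hI.tensorQuotientEquiv X)
    refine ⟨.of_simple_quotient hf, ?_⟩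
    rw [cls_of_simple_quotient hs hf, cls_of_simple_quotient hX hXf, map_add, ← ih.2, cls_congr e,
      shiftG_single, shift_mk,
      SimpleClass.mk_eq_mk (hT := hI.isSimpleModule_tensor hX) (hI.tensorQuotientEquiv X)]

end IsInvertibleIdeal

end Invertible

/-! ### Powers of an invertible ideal -/

section Powers

variable {R : Type u} [Ring R]
variable {N : Type u} [AddCommGroup N] [Module R N]

lemma nonempty_tensor_equiv_of_eq {I J : Ideal R} [I.IsTwoSided] [J.IsTwoSided] (h : I = J) :
    Nonempty (Tensor I N ≃ₗ[R] Tensor J N) := by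
  subst h; exact ⟨LinearEquiv.refl R _⟩

/-- The ideal enters through an equation so that the lemma applies to `I ^ 0` with its own
two-sidedness instance. -/
lemma nonempty_tensor_one_equiv {J : Ideal R} [J.IsTwoSided] (hJ : J = ⊤) :
    Nonempty (Tensor J N ≃ₗ[R] N) := by
  subst hJ
  refine ⟨LinearEquiv.ofBijective (tensorMul ⊤ N) ⟨?_, fun n => ⟨tmk ⊤ ⟨1, trivial⟩ n, ?_⟩⟩⟩
  · have key : ∀ t : Tensor (⊤ : Ideal R) N, t = tmk ⊤ ⟨1, trivial⟩ (tensorMul ⊤ N t) := by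
      intro t
      induction t using tensor_induction with
      | h0 => rw [map_zero, tmk, TensorProduct.tmul_zero, map_zero]
      | h x n =>
        rw [tensorMul_tmk, ← tmk_mul]
        congr 1
        exact Subtype.ext (one_mul _).symm
      | hadd a b ha hb => rw [map_add, tmk_add_right, ← ha, ← hb]
    intro s t h
    rw [key s, key t, h]
  · rw [tensorMul_tmk, one_smul]

variable (I J : Ideal R) [I.IsTwoSided] [J.IsTwoSided]

/-- Left multiplication by an element of `I`, from `J` to `I J`. -/
def mulLeftHom : I →ₗ[R] J →+ (I * J : Ideal R) where
  toFun x := AddMonoidHom.mk' (fun y => ⟨x * y, Ideal.mul_mem_mul x.2 y.2⟩)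
    fun y z => Subtype.ext (mul_add _ _ _)
  map_add' x y := by ext z; exact add_mul _ _ _
  map_smul' r x := by ext z; exact mul_assoc _ _ _

variable (N) in
/-- The map `t ↦ x t` from `J ⊗ N` to `(I J) ⊗ N`, for `x` in `I`, before passing to the
quotient. -/
def mulTensorPre (x : I) : (J ⊗[ℤ] N) →+ Tensor (I * J) N :=
  (tensorRel (I * J) N).mkQ.toAddMonoidHom.comp
    (LinearMap.rTensor N (mulLeftHom I J x).toIntLinearMap).toAddMonoidHom

omit [I.IsTwoSided] in
lemma mulTensorPre_tmul (x : I) (y : J) (n : N) :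
    mulTensorPre N I J x (y ⊗ₜ[ℤ] n) = tmk (I * J) (mulLeftHom I J x y) n := rfl

lemma mulTensorPre_smul (x : I) (r : R) (t : J ⊗[ℤ] N) :
    mulTensorPre N I J x (r • t) = mulTensorPre N I J ⟨x * r, I.mul_mem_right r x.2⟩ t := by
  induction t with
  | zero => simp
  | tmul y n =>
    rw [TensorProduct.smul_tmul', mulTensorPre_tmul, mulTensorPre_tmul]
    congr 1
    exact Subtype.ext (mul_assoc _ _ _).symm
  | add a b ha hb => rw [smul_add, map_add, map_add, ha, hb]

lemma mulTensorPre_eq_zero (x : I) {t : J ⊗[ℤ] N} (ht : t ∈ tensorRel J N) :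
    mulTensorPre N I J x t = 0 := by
  induction ht using Submodule.span_induction generalizing x with
  | mem t ht =>
    obtain ⟨y, r, n, rfl⟩ := ht
    rw [map_sub, mulTensorPre_tmul, mulTensorPre_tmul, ← tmk_mul, sub_eq_zero]
    congr 1
    exact Subtype.ext (mul_assoc _ _ _).symm
  | zero => exact map_zero _
  | add a b _ _ ha hb => rw [map_add, ha, hb, add_zero]
  | smul r t _ ih => rw [mulTensorPre_smul, ih]

variable (N) in
/-- The map `t ↦ x t` from `J ⊗ N` to `(I J) ⊗ N`, for `x` in `I`. -/
def mulTensorHom (x : I) : Tensor J N →+ Tensor (I * J) N :=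
  QuotientAddGroup.lift (tensorRel J N).toAddSubgroup (mulTensorPre N I J x)
    fun _ ht => mulTensorPre_eq_zero I J x ht

lemma mulTensorHom_tmk (x : I) (y : J) (n : N) :
    mulTensorHom N I J x (tmk J y n) = tmk (I * J) (mulLeftHom I J x y) n := rfl

lemma mulTensorHom_smul (x : I) (r : R) (t : Tensor J N) :
    mulTensorHom N I J ⟨x * r, I.mul_mem_right r x.2⟩ t = mulTensorHom N I J x (r • t) := by
  obtain ⟨t, rfl⟩ := (tensorRel J N).mkQ_surjective t
  exact (mulTensorPre_smul I J x r t).symm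

variable (N) in
/-- The multiplication map `I ⊗ (J ⊗ N) → (I J) ⊗ N`. -/
def tensorTensorMul : Tensor I (Tensor J N) →ₗ[R] Tensor (I * J) N :=
  tensorLift I
    { toFun := mulTensorHom N I J
      map_add' := fun x y => by
        ext t
        induction t using tensor_induction with
        | h0 => simp
        | h z n => simp only [AddMonoidHom.add_apply, mulTensorHom_tmk, map_add, tmk_add_left]
        | hadd a b ha hb => simp only [map_add, ha, hb]
      map_smul' := fun r x => by
        ext t
        induction t using tensor_induction with
        | h0 => simp
        | h z n =>
          rw [AddMonoidHom.smul_apply, RingHom.id_apply, mulTensorHom_tmk, mulTensorHom_tmk,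
            smul_tmk, map_smul]
          rfl
        | hadd a b ha hb => simp only [map_add, ha, hb] }
    fun x r t => mulTensorHom_smul I J x r t

lemma tensorTensorMul_tmk (x : I) (y : J) (n : N) :
    tensorTensorMul N I J (tmk I x (tmk J y n)) = tmk (I * J) (mulLeftHom I J x y) n := rfl

/-- The multiplication map `I ⊗ J → I J`. -/
def tensorIdealMul : Tensor I J →ₗ[R] (I * J : Ideal R) :=
  tensorLift I (mulLeftHom I J) fun _ _ _ => Subtype.ext (mul_assoc _ _ _)

omit [J.IsTwoSided] in
lemma tensorIdealMul_tmk (x : I) (y : J) :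
    tensorIdealMul I J (tmk I x y) = mulLeftHom I J x y := rfl

variable {I}

-- Followed by the inclusion into `R`, the map is `I ⊗ J → I ⊗ R → R`: the first arrow is injective
-- because equivalences preserve monomorphisms, the second because `R` is projective over itself.
omit [J.IsTwoSided] in
lemma IsInvertibleIdeal.tensorIdealMul_bijective (hI : IsInvertibleIdeal I) :
    Function.Bijective (tensorIdealMul I J) := by
  constructor
  · have h : Function.Injective (tensorMul I R ∘ₗ tensorMap I (Submodule.subtype J)) :=
      (tensorMul_injective I).comp (hI.tensorMap_injective J.injective_subtype)
    have : Submodule.subtype (I * J : Ideal R) ∘ₗ tensorIdealMul I J =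
        tensorMul I R ∘ₗ tensorMap I (Submodule.subtype J) :=
      tensor_hom_ext I fun x n => rfl
    rw [← this] at h
    exact Function.Injective.of_comp (f := Submodule.subtype (I * J : Ideal R)) h
  · rintro ⟨z, hz⟩
    induction hz using Submodule.mul_induction_on' with
    | mem_mul_mem x hx y hy => exact ⟨tmk I ⟨x, hx⟩ ⟨y, hy⟩, rfl⟩
    | add a ha b hb iha ihb =>
      obtain ⟨s, hs⟩ := iha
      obtain ⟨t, ht⟩ := ihb
      exact ⟨s + t, by rw [map_add, hs, ht]; rfl⟩

/-- The map `y ↦ y ⊗ n`. -/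
def tmkLeft (n : N) : J →ₗ[R] Tensor J N where
  toFun y := tmk J y n
  map_add' y z := tmk_add_left J y z n
  map_smul' _ _ := rfl

/-- Right multiplication by `r` on a two-sided ideal. -/
def mulRightHom (r : R) : J →ₗ[R] J where
  toFun y := ⟨y * r, J.mul_mem_right r y.2⟩
  map_add' _ _ := Subtype.ext (add_mul _ _ _)
  map_smul' _ _ := Subtype.ext (mul_assoc _ _ _)

lemma tmkLeft_add (n n' : N) : tmkLeft J (n + n') = tmkLeft J n + tmkLeft J n' :=
  LinearMap.ext fun y => tmk_add_right J y n n'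

lemma tmkLeft_comp_mulRightHom (n : N) (r : R) :
    tmkLeft J n ∘ₗ mulRightHom J r = tmkLeft J (r • n) :=
  LinearMap.ext fun y => tmk_mul J y r n

lemma tensorMap_add {N' : Type u} [AddCommGroup N'] [Module R N'] (f g : N →ₗ[R] N') :
    tensorMap I (f + g) = tensorMap I f + tensorMap I g :=
  tensor_hom_ext I fun x n => tmk_add_right I x (f n) (g n)

lemma tensorIdealMul_mulRightHom (r : R) (t : Tensor I J) :
    (tensorIdealMul I J (tensorMap I (mulRightHom J r) t) : R) = tensorIdealMul I J t * r := by
  induction t using tensor_induction with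
  | h0 => simp
  | h x y => exact (mul_assoc _ _ _).symm
  | hadd a b ha hb => simp only [map_add, Submodule.coe_add, ha, hb, add_mul]

/-- `I ⊗ J ≃ I J` for an invertible ideal `I`. -/
def IsInvertibleIdeal.tensorIdealEquiv (hI : IsInvertibleIdeal I) :
    Tensor I J ≃ₗ[R] (I * J : Ideal R) :=
  LinearEquiv.ofBijective _ (hI.tensorIdealMul_bijective J)

/-- Right linearity of the inverse, needed for `splitHom` to be balanced over `R`. -/
lemma IsInvertibleIdeal.tensorIdealEquiv_symm_mul (hI : IsInvertibleIdeal I)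
    (z : (I * J : Ideal R)) (r : R) :
    (hI.tensorIdealEquiv J).symm ⟨z * r, (I * J).mul_mem_right r z.2⟩ =
      tensorMap I (mulRightHom J r) ((hI.tensorIdealEquiv J).symm z) := by
  rw [LinearEquiv.symm_apply_eq]
  refine Subtype.ext ?_
  refine Eq.trans ?_ (tensorIdealMul_mulRightHom J r _).symm
  exact congrArg (fun w : (I * J : Ideal R) => (w : R) * r)
    ((hI.tensorIdealEquiv J).apply_symm_apply z).symm

/-- The bilinear map `(x y, n) ↦ x ⊗ (y ⊗ n)`. -/
def IsInvertibleIdeal.splitHom (hI : IsInvertibleIdeal I) :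
    (I * J : Ideal R) →ₗ[R] N →+ Tensor I (Tensor J N) where
  toFun z := AddMonoidHom.mk'
    (fun n => tensorMap I (tmkLeft J n) ((hI.tensorIdealEquiv J).symm z))
    fun n n' => by rw [tmkLeft_add, tensorMap_add, LinearMap.add_apply]
  map_add' z z' := AddMonoidHom.ext fun n => by
    simp only [AddMonoidHom.mk'_apply, AddMonoidHom.add_apply, map_add]
  map_smul' r z := AddMonoidHom.ext fun n => by
    simp only [AddMonoidHom.mk'_apply, AddMonoidHom.smul_apply, map_smul, RingHom.id_apply]

lemma IsInvertibleIdeal.splitHom_apply (hI : IsInvertibleIdeal I) (z : (I * J : Ideal R))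
    (n : N) : hI.splitHom J z n =
      tensorMap I (tmkLeft J n) ((hI.tensorIdealEquiv J).symm z) := rfl

/-- The inverse of the multiplication map `I ⊗ (J ⊗ N) → (I J) ⊗ N`. -/
def IsInvertibleIdeal.tensorSplit (hI : IsInvertibleIdeal I) :
    Tensor (I * J) N →ₗ[R] Tensor I (Tensor J N) :=
  tensorLift (I * J) (hI.splitHom J) fun z r n => by
    rw [splitHom_apply, splitHom_apply, tensorIdealEquiv_symm_mul, ← LinearMap.comp_apply,
      ← tensorMap_comp, tmkLeft_comp_mulRightHom]

lemma IsInvertibleIdeal.tensorSplit_tmk (hI : IsInvertibleIdeal I) (z : (I * J : Ideal R))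
    (n : N) : hI.tensorSplit J (tmk (I * J) z n) =
      tensorMap I (tmkLeft J n) ((hI.tensorIdealEquiv J).symm z) := rfl

/-- Associativity combined with `I ⊗ J ≃ I J`. It turns `I ^ k ⊗ -` into the `k`-fold iterate of `I
⊗ -`, so its effect on classes is the iterated shift. -/
lemma IsInvertibleIdeal.nonempty_tensor_tensor_equiv (hI : IsInvertibleIdeal I) :
    Nonempty (Tensor I (Tensor J N) ≃ₗ[R] Tensor (I * J) N) := by
  have hL : hI.tensorSplit J ∘ₗ tensorTensorMul N I J = LinearMap.id := by
    refine tensor_hom_ext I fun x t => ?_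
    change hI.tensorSplit J (tensorTensorMul N I J (tmk I x t)) = tmk I x t
    induction t using tensor_induction with
    | h0 => rw [tmk, TensorProduct.tmul_zero, map_zero, map_zero, map_zero]
    | h y n =>
      rw [tensorTensorMul_tmk, tensorSplit_tmk, ← tensorIdealMul_tmk]
      exact congrArg _ ((hI.tensorIdealEquiv J).symm_apply_apply (tmk I x y))
    | hadd a b ha hb => rw [tmk_add_right, map_add, map_add, ha, hb]
  have hL' : tensorTensorMul N I J ∘ₗ hI.tensorSplit J = LinearMap.id := by
    refine tensor_hom_ext _ fun z n => ?_
    change tensorTensorMul N I J (hI.tensorSplit J (tmk (I * J) z n)) = tmk (I * J) z n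
    obtain ⟨t, rfl⟩ := (hI.tensorIdealEquiv J).surjective z
    rw [tensorSplit_tmk, LinearEquiv.symm_apply_apply]
    induction t using tensor_induction with
    | h0 => rw [map_zero, map_zero, map_zero, tmk, TensorProduct.zero_tmul, map_zero]
    | h x y => rfl
    | hadd a b ha hb => rw [map_add, map_add, ha, hb, map_add, tmk_add_left]
  exact ⟨LinearEquiv.ofLinearMap _ _ hL' hL⟩

lemma IsInvertibleIdeal.isFiniteLength_cls_tensor_pow (hI : IsInvertibleIdeal I)
    (h : IsFiniteLength R N) (k : ℕ) : IsFiniteLength R (Tensor (I ^ k) N) ∧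
      cls R (Tensor (I ^ k) N) = hI.shiftG^[k] (cls R N) := by
  induction k with
  | zero =>
    obtain ⟨e⟩ := nonempty_tensor_one_equiv (N := N) (J := I ^ 0)
      (by rw [Submodule.pow_zero, Ideal.one_eq_top])
    exact ⟨e.symm.isFiniteLength h, cls_congr e⟩
  | succ k ih =>
    obtain ⟨e⟩ := nonempty_tensor_equiv_of_eq (N := N) (Ideal.IsTwoSided.pow_succ (I := I) k)
    obtain ⟨e'⟩ := hI.nonempty_tensor_tensor_equiv (N := N) (I ^ k)
    have := hI.isFiniteLength_cls_tensor ih.1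
    refine ⟨(e'.trans e.symm).isFiniteLength this.1, ?_⟩
    rw [cls_congr (e.trans e'.symm), this.2, ih.2, Function.iterate_succ_apply']

/-- `I` commutes with its powers, so `I ^ k ⊗ N` stays an `R/I`-module. Homomorphisms to it from
`M/IM` and from `M` therefore agree. -/
lemma smul_tensor_pow_eq_zero (h : ∀ a ∈ I, ∀ n : N, a • n = 0) (k : ℕ) :
    ∀ a ∈ I, ∀ t : Tensor (I ^ k) N, a • t = 0 :=
  smul_tensor_eq_zero (by rw [← Ideal.IsTwoSided.pow_succ, Submodule.pow_succ]) h

end Powers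

/-! ### Complements of a kernel -/

section Complements

variable {R : Type u} [Ring R]

/-- The complements of the kernel of a split surjection are a torsor under homomorphisms. -/
def complKerEquiv {Q A : Type u} [AddCommGroup Q] [Module R Q] [AddCommGroup A] [Module R A]
    (p : Q →ₗ[R] A) (s : A →ₗ[R] Q) (hps : p ∘ₗ s = LinearMap.id) :
    {T // IsCompl (LinearMap.ker p) T} ≃ (A →ₗ[R] LinearMap.ker p) :=
  have hs : ∀ a, p (s a) = a := LinearMap.congr_fun hps
  let f₀ : Q →ₗ[R] LinearMap.ker p := (LinearMap.id - s ∘ₗ p).codRestrict _ fun q => by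
    simp [hs]
  -- A complement is a projection onto the kernel. Such a projection is the identity on the kernel,
  -- so it is determined by its restriction along the section `s`, which may be arbitrary.
  (Submodule.isComplEquivProj (LinearMap.ker p)).trans
    { toFun := fun f => f.1 ∘ₗ s
      invFun := fun t => ⟨f₀ + t ∘ₗ p, fun x => Subtype.ext (by
        have hx : p x = 0 := x.2
        simp [f₀, hx])⟩
      left_inv := fun f => Subtype.ext (LinearMap.ext fun q => by
        have h1 := f.2 (f₀ q)
        have h2 : (f₀ q : Q) = q - s (p q) := rfl
        rw [h2, map_sub] at h1
        simp [← h1])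
      right_inv := fun t => LinearMap.ext fun a => Subtype.ext (by simp [f₀, hs]) }

variable {M : Type u} [AddCommGroup M] [Module R M]

/-- The submodule of `M` that corresponds to a submodule of the subquotient `W / L`. -/
def liftSub (W L : Submodule R M) (T : Submodule R (W ⧸ L.comap W.subtype)) : Submodule R M :=
  (T.comap (L.comap W.subtype).mkQ).map W.subtype

lemma mem_liftSub {W L : Submodule R M} {T : Submodule R (W ⧸ L.comap W.subtype)} {m : M} :
    m ∈ liftSub W L T ↔ ∃ h : m ∈ W, (L.comap W.subtype).mkQ ⟨m, h⟩ ∈ T := by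
  constructor
  · rintro ⟨w, hw, rfl⟩; exact ⟨w.2, hw⟩
  · rintro ⟨h, hm⟩; exact ⟨⟨m, h⟩, hm, rfl⟩

/-- Submodules of `W / L` correspond to submodules between `L` and `W`. -/
def liftSubIso {W L : Submodule R M} (hLW : L ≤ W) :
    Submodule R (W ⧸ L.comap W.subtype) ≃o Set.Icc L W where
  toFun T := ⟨liftSub W L T, fun m hm => mem_liftSub.mpr ⟨hLW hm, by
      rw [Submodule.mkQ_apply, (Submodule.Quotient.mk_eq_zero _).mpr (by exact hm)]
      exact T.zero_mem⟩, fun m hm => (mem_liftSub.mp hm).1⟩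
  invFun X := (X.1.comap W.subtype).map (L.comap W.subtype).mkQ
  left_inv T := by
    ext q
    obtain ⟨w, rfl⟩ := (L.comap W.subtype).mkQ_surjective q
    constructor
    · rintro ⟨v, hv, hvw⟩
      obtain ⟨h, hv⟩ := mem_liftSub.mp hv
      rwa [← hvw]
    · intro h
      exact ⟨w, mem_liftSub.mpr ⟨w.2, h⟩, rfl⟩
  right_inv X := by
    refine Subtype.ext ?_
    ext m
    rw [mem_liftSub]
    constructor
    · rintro ⟨h, w, hw, hwm⟩
      have : w - ⟨m, h⟩ ∈ L.comap W.subtype := (Submodule.Quotient.eq _).mp hwm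
      have h2 := X.1.sub_mem hw (X.2.1 this)
      simpa using h2
    · intro h
      exact ⟨X.2.2 h, _, h, rfl⟩
  map_rel_iff' {T T'} := by
    constructor
    · intro h q hq
      obtain ⟨w, rfl⟩ := (L.comap W.subtype).mkQ_surjective q
      exact (mem_liftSub.mp (h (mem_liftSub.mpr ⟨w.2, hq⟩))).2
    · intro h m hm
      obtain ⟨hw, hT⟩ := mem_liftSub.mp hm
      exact mem_liftSub.mpr ⟨hw, h hT⟩

/-- Relative complements in an interval correspond to complements in the subquotient. -/
def relComplEquiv {W L V : Submodule R M} (hLW : L ≤ W) (hV : V ∈ Set.Icc L W) :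
    {X // V ⊓ X = L ∧ V ⊔ X = W} ≃
      {T // IsCompl ((liftSubIso hLW).symm ⟨V, hV⟩) T} :=
  have : Fact (L ≤ W) := ⟨hLW⟩
  { toFun := fun X => ⟨(liftSubIso hLW).symm ⟨X.1, X.2.1.ge.trans inf_le_right, le_sup_right.trans X.2.2.le⟩, by
      rw [← OrderIso.isCompl_iff, isCompl_iff, disjoint_iff, codisjoint_iff]
      exact ⟨Subtype.ext X.2.1, Subtype.ext X.2.2⟩⟩
    invFun := fun T => ⟨(liftSubIso hLW T.1).1, by
      have h := (OrderIso.isCompl_iff (liftSubIso hLW)).mp T.2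
      rw [OrderIso.apply_symm_apply, isCompl_iff, disjoint_iff, codisjoint_iff] at h
      exact ⟨congrArg Subtype.val h.1, congrArg Subtype.val h.2⟩⟩
    left_inv := fun X => Subtype.ext (by simp)
    right_inv := fun T => Subtype.ext ((liftSubIso hLW).symm_apply_apply T.1) }

end Complements

/-! ### Submodules of a projective module and multiplication by an invertible ideal -/

section Colon

variable {R : Type u} [Ring R] (I : Ideal R) [I.IsTwoSided]
variable {M : Type u} [AddCommGroup M] [Module R M]

/-- The elements `m` with `I m ⊆ X`. -/
def colon (X : Submodule R M) : Submodule R M where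
  carrier := {m | ∀ a ∈ I, a • m ∈ X}
  add_mem' ha hb a hI := by rw [smul_add]; exact X.add_mem (ha a hI) (hb a hI)
  zero_mem' a _ := by rw [smul_zero]; exact X.zero_mem
  smul_mem' r m hm a ha := by rw [← mul_smul]; exact hm _ (I.mul_mem_right r ha)

variable {I}

lemma le_colon_iff {X Y : Submodule R M} : Y ≤ colon I X ↔ I • Y ≤ X :=
  ⟨fun h => Submodule.smul_le.mpr fun a ha _ hy => h hy a ha,
    fun h _ hy _ ha => h (Submodule.smul_mem_smul ha hy)⟩

lemma le_colon (X : Submodule R M) : X ≤ colon I X := fun _ hx a _ => X.smul_mem a hx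

lemma map_tensorMul_range (X : Submodule R M) :
    (LinearMap.range (tensorMap I X.subtype)).map (tensorMul I M) = I • X := by
  rw [← LinearMap.range_comp,
    show tensorMul I M ∘ₗ tensorMap I X.subtype = X.subtype ∘ₗ tensorMul I X from
      LinearMap.ext (tensorMul_natural I _), LinearMap.range_comp, range_tensorMul,
    Submodule.map_smul'', Submodule.map_top, Submodule.range_subtype]

namespace IsInvertibleIdeal

variable [Module.Finite R M] [Module.Projective R M] (hI : IsInvertibleIdeal I)

include hI

lemma smul_le_smul_iff {X Y : Submodule R M} : I • X ≤ I • Y ↔ X ≤ Y := by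
  rw [← map_tensorMul_range, ← map_tensorMul_range,
    Submodule.map_le_map_iff_of_injective (tensorMul_injective I), hI.range_tensorMap_le_iff]

omit [Module.Finite R M] [Module.Projective R M] in
lemma exists_smul_eq {T : Submodule R M} (hT : T ≤ I • ⊤) : ∃ X : Submodule R M, I • X = T := by
  obtain ⟨X, hX⟩ := hI.exists_range_tensorMap_eq (T.comap (tensorMul I M))
  refine ⟨X, ?_⟩
  rw [← map_tensorMul_range, hX, Submodule.map_comap_eq, range_tensorMul, inf_eq_right.mpr hT]

-- Every submodule of `IM` has the form `I Y`; if `I Y` lies in `X`, then `Y` lies in the colon.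
omit [Module.Finite R M] [Module.Projective R M] in
lemma smul_colon (X : Submodule R M) : I • colon I X = X ⊓ I • ⊤ := by
  refine le_antisymm (le_inf (le_colon_iff.mp le_rfl) (Submodule.smul_mono le_rfl le_top)) ?_
  obtain ⟨Y, hY⟩ := hI.exists_smul_eq (T := X ⊓ I • ⊤) inf_le_right
  rw [← hY]
  exact Submodule.smul_mono le_rfl (le_colon_iff.mpr (hY.trans_le inf_le_left))

lemma colon_eq_iff {X X' : Submodule R M} : colon I X = X' ↔ I • ⊤ ⊓ X = I • X' := by
  rw [inf_comm, ← hI.smul_colon]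
  refine ⟨fun h => by rw [h], fun h => le_antisymm ?_ ?_⟩
  · exact hI.smul_le_smul_iff.mp h.le
  · exact hI.smul_le_smul_iff.mp h.ge

lemma nonempty_smul_quotient_equiv (X : Submodule R M) :
    Nonempty (((I • ⊤ : Submodule R M) ⧸ (I • X).comap (I • ⊤ : Submodule R M).subtype) ≃ₗ[R]
      Tensor I (M ⧸ X)) := by
  let e : Tensor I M ≃ₗ[R] (I • ⊤ : Submodule R M) :=
    (LinearEquiv.ofInjective _ (tensorMul_injective I)).trans
      (LinearEquiv.ofEq _ _ (range_tensorMul I))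
  refine ⟨((Submodule.Quotient.equiv _ _ e ?_).symm.trans (hI.tensorQuotientEquiv X))⟩
  -- Both submodules of `IM` are compared after inclusion into `M`, where each becomes `I X`.
  refine Submodule.map_injective_of_injective (Submodule.injective_subtype (I • ⊤)) ?_
  rw [Submodule.map_comap_subtype, inf_eq_right.mpr (Submodule.smul_mono le_rfl le_top)]
  refine Eq.trans ?_ (map_tensorMul_range X)
  rw [← Submodule.map_comp]
  rfl

lemma isFiniteLength_cls_smul_quotient {X : Submodule R M} (h : IsFiniteLength R (M ⧸ X)) :
    IsFiniteLength R ((I • ⊤ : Submodule R M) ⧸ (I • X).comap (I • ⊤ : Submodule R M).subtype) ∧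
    cls R ((I • ⊤ : Submodule R M) ⧸ (I • X).comap (I • ⊤ : Submodule R M).subtype) =
      hI.shiftG (cls R (M ⧸ X)) := by
  obtain ⟨e⟩ := hI.nonempty_smul_quotient_equiv X
  have := hI.isFiniteLength_cls_tensor h
  exact ⟨e.symm.isFiniteLength this.1, (cls_congr e).trans this.2⟩

omit hI [I.IsTwoSided] [Module.Finite R M] [Module.Projective R M] in
/-- The second isomorphism theorem for `X + Y`, in the form used below. -/
lemma nonempty_sup_quotient_equiv (Y X : Submodule R M) {T : Submodule R M} (hT : Y ⊓ X = T) :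
    Nonempty ((Y ⧸ T.comap Y.subtype) ≃ₗ[R] (X ⊔ Y : Submodule R M) ⧸
      X.comap (X ⊔ Y : Submodule R M).subtype) := by
  rw [sup_comm X Y]
  refine ⟨(Submodule.quotEquivOfEq _ _ ?_).trans (LinearMap.quotientInfEquivSupQuotient Y X)⟩
  rw [← hT, Submodule.comap_inf]

/-- The chain `X ≤ X + IM ≤ M` has first factor `IM / I (colon X)`, by the second isomorphism
theorem. So finite colength can be read off from the pair attached to `X`. -/
lemma isFiniteLength_of_colon_sup {X : Submodule R M} (h : IsFiniteLength R (M ⧸ colon I X))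
    (h' : IsFiniteLength R (M ⧸ (X ⊔ I • ⊤))) : IsFiniteLength R (M ⧸ X) := by
  obtain ⟨e⟩ := nonempty_sup_quotient_equiv (I • ⊤) X (hI.colon_eq_iff.mp rfl)
  exact isFiniteLength_quotient_of_subquotient le_sup_left
    (e.isFiniteLength (hI.isFiniteLength_cls_smul_quotient h).1) h'

lemma cls_quotient_eq_shift_add {X : Submodule R M} (h : IsFiniteLength R (M ⧸ X)) :
    cls R (M ⧸ X) = hI.shiftG (cls R (M ⧸ colon I X)) + cls R (M ⧸ (X ⊔ I • ⊤)) := by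
  obtain ⟨e⟩ := nonempty_sup_quotient_equiv (I • ⊤) X (hI.colon_eq_iff.mp rfl)
  rw [cls_quotient_of_le (le_sup_left : X ≤ X ⊔ I • ⊤) h, ← cls_congr e,
    (hI.isFiniteLength_cls_smul_quotient (isFiniteLength_quotient_of_le (le_colon X) h)).2]

end IsInvertibleIdeal

omit [I.IsTwoSided] in
lemma nonempty_map_equiv_modI
    (hiso : ∀ X X' : FinColength R (ModI I M), Nonempty (X.1 ≃ₗ[R] X'.1))
    {Y : Submodule R M} (hIY : I • ⊤ ≤ Y) (hY : IsFiniteLength R (M ⧸ Y)) :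
    Nonempty (Y.map (I • (⊤ : Submodule R M)).mkQ ≃ₗ[R] ModI I M) := by
  obtain ⟨e⟩ := hiso ⟨Y.map (I • (⊤ : Submodule R M)).mkQ,
    (Submodule.quotientQuotientEquivQuotient _ Y hIY).symm.isFiniteLength hY⟩
    ⟨⊤, .of_subsingleton⟩
  exact ⟨e.trans Submodule.topEquiv⟩

/-! ### Counting the submodules with given colon and given sum with `IM`. -/

namespace IsInvertibleIdeal

variable [Module.Finite R M] [Module.Projective R M] (hI : IsInvertibleIdeal I)

include hI

/-- The fibre is the set of complements of the kernel of a split surjection `Q → M/IM`, so it has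
`|Hom(M, K)|` elements with `K = (X' ∩ IM)/I X'`. Comparing `IM / I X'` with `M/X'` along `X' ∩ IM`
gives `[K]`; the formula is cross-multiplied to avoid division. -/
lemma card_fiber (hiso : ∀ X X' : FinColength R (ModI I M), Nonempty (X.1 ≃ₗ[R] X'.1))
    {X' Y : Submodule R M} (hX' : IsFiniteLength R (M ⧸ X')) (hY : IsFiniteLength R (M ⧸ Y))
    (hIY : I • ⊤ ≤ Y) (hYX : Y ≤ X' ⊔ I • ⊤) :
    (Nat.card {X : Submodule R M // colon I X = X' ∧ X ⊔ I • ⊤ = Y} : ℂ) *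
      homCard M (cls R (M ⧸ X')) =
    homCard M (hI.shiftG (cls R (M ⧸ X'))) * homCard M (cls R (M ⧸ (X' ⊔ I • ⊤))) := by
  let B : Submodule R M := I • ⊤
  let W := X' ⊓ Y
  let V := X' ⊓ B
  let L := I • X'
  have hLX : L ≤ X' := Submodule.smul_le_right
  have hLB : L ≤ B := Submodule.smul_mono le_rfl le_top
  have hLV : L ≤ V := le_inf hLX hLB
  have hVW : V ≤ W := le_inf inf_le_left (inf_le_right.trans hIY)
  have hLW : L ≤ W := hLV.trans hVW
  -- The modular law together with `Y ≤ X' + IM`; this identifies `W/V` with `Y/IM`.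
  have hWB : W ⊔ B = Y := by
    change X' ⊓ Y ⊔ B = Y
    rw [sup_comm, ← sup_inf_assoc_of_le X' hIY, sup_comm, inf_eq_right]
    exact hYX
  have hWV : W ⊓ B = V := by
    change X' ⊓ Y ⊓ B = X' ⊓ B
    rw [inf_assoc, inf_eq_right.mpr hIY]
  -- the fibre consists of relative complements
  let e₁ : {X : Submodule R M // colon I X = X' ∧ X ⊔ I • ⊤ = Y} ≃
      {X // V ⊓ X = L ∧ V ⊔ X = W} := Equiv.subtypeEquivRight fun X => by
    rw [hI.colon_eq_iff]
    constructor
    · rintro ⟨h1, h2⟩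
      have hX : X ≤ X' := hI.colon_eq_iff.mpr h1 ▸ le_colon X
      refine ⟨?_, ?_⟩
      · change X' ⊓ B ⊓ X = L
        rw [inf_assoc, show B ⊓ X = L from h1, inf_eq_right.mpr hLX]
      · change X' ⊓ B ⊔ X = X' ⊓ Y
        rw [← h2, sup_comm, inf_comm X' B, ← sup_inf_assoc_of_le B hX, inf_comm]
    · rintro ⟨h1, h2⟩
      have hX : X ≤ X' := (le_sup_right.trans_eq h2).trans inf_le_left
      refine ⟨?_, ?_⟩
      · refine Eq.trans ?_ h1
        change B ⊓ X = X' ⊓ B ⊓ X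
        rw [inf_assoc, inf_eq_right.mpr (inf_le_right.trans hX)]
      · rw [← hWB, ← h2, sup_comm V X, sup_assoc, sup_eq_right.mpr (inf_le_right : V ≤ B)]
  let Q := W ⧸ L.comap W.subtype
  -- the projection of `Q` onto `M/IM`
  obtain ⟨e⟩ := nonempty_map_equiv_modI hiso hIY hY
  let p₀ : W →ₗ[R] Y.map B.mkQ := B.mkQ.restrict fun x hx => Submodule.mem_map_of_mem hx.2
  have hp₀ : ∀ w : W, p₀ w = 0 ↔ (w : M) ∈ B := fun w => by
    rw [← Submodule.Quotient.mk_eq_zero B]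
    exact Subtype.ext_iff
  let p₁ : Q →ₗ[R] Y.map B.mkQ := (L.comap W.subtype).liftQ p₀ fun w hw => (hp₀ w).mpr (hLB hw)
  have hp₁ : Function.Surjective p₁ := by
    rintro ⟨_, y, hy, rfl⟩
    have hy' : y ∈ W ⊔ B := hWB ▸ hy
    obtain ⟨w, hw, b, hb, rfl⟩ := Submodule.mem_sup.mp hy'
    refine ⟨(L.comap W.subtype).mkQ ⟨w, hw⟩, Subtype.ext ?_⟩
    change B.mkQ w = B.mkQ (w + b)
    rw [map_add, Submodule.mkQ_apply B b, (Submodule.Quotient.mk_eq_zero B).mpr hb, add_zero]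
  let p : Q →ₗ[R] ModI I M := e.toLinearMap ∘ₗ p₁
  have hp : Function.Surjective p := e.surjective.comp hp₁
  have hker : (liftSubIso hLW).symm ⟨V, hLV, hVW⟩ = LinearMap.ker p := by
    rw [OrderIso.symm_apply_eq]
    refine Subtype.ext ?_
    change V = liftSub W L (LinearMap.ker p)
    ext m
    rw [mem_liftSub]
    have : ∀ h : m ∈ W, (L.comap W.subtype).mkQ ⟨m, h⟩ ∈ LinearMap.ker p ↔ m ∈ B := fun h => by
      rw [LinearMap.mem_ker]
      change e (p₀ ⟨m, h⟩) = 0 ↔ _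
      rw [LinearEquiv.map_eq_zero_iff, hp₀]
    rw [← hWV]
    exact ⟨fun h => ⟨h.1, (this h.1).mpr h.2⟩, fun ⟨h, h'⟩ => ⟨h, (this h).mp h'⟩⟩
  have hQI : ∀ a ∈ I, ∀ q : Q, a • q = 0 := fun a ha q => by
    obtain ⟨w, rfl⟩ := (L.comap W.subtype).mkQ_surjective q
    rw [← map_smul]
    exact (Submodule.Quotient.mk_eq_zero _).mpr (Submodule.smul_mem_smul ha w.2.1)
  -- `M/IM` need not be projective over `R`. Instead `M → M/IM` is lifted to `Q`, and the lift
  -- factors through `M/IM` because `I` kills `Q`.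
  obtain ⟨s₀, hs₀⟩ := Module.projective_lifting_property p B.mkQ hp
  let s : ModI I M →ₗ[R] Q := (homModIEquiv I hQI).symm s₀
  have hs : p ∘ₗ s = LinearMap.id := by
    refine Submodule.linearMap_qext _ ?_
    rw [LinearMap.comp_assoc, show s ∘ₗ B.mkQ = s₀ from (homModIEquiv I hQI).apply_symm_apply s₀]
    exact hs₀
  -- the class of the kernel
  let V' : Submodule R B := V.comap B.subtype
  let L' : Submodule R B := L.comap B.subtype
  have hK : Nonempty ((V' ⧸ L'.comap V'.subtype) ≃ₗ[R] LinearMap.ker p) := by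
    let q : V' →ₗ[R] LinearMap.ker p :=
      LinearMap.codRestrict _ ((L.comap W.subtype).mkQ ∘ₗ
        (B.subtype ∘ₗ V'.subtype).codRestrict W fun v => hVW v.2) fun v => by
          rw [LinearMap.mem_ker]
          change e (p₀ _) = 0
          rw [LinearEquiv.map_eq_zero_iff, hp₀]
          exact v.1.2
    have hq : Function.Surjective q := by
      rintro ⟨k, hk⟩
      obtain ⟨w, rfl⟩ := (L.comap W.subtype).mkQ_surjective k
      rw [LinearMap.mem_ker] at hk
      change e (p₀ _) = 0 at hk
      rw [LinearEquiv.map_eq_zero_iff, hp₀] at hk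
      exact ⟨⟨⟨w, hk⟩, ⟨w.2.1, hk⟩⟩, rfl⟩
    refine ⟨(Submodule.quotEquivOfEq _ _ ?_).trans (q.quotKerEquivOfSurjective hq)⟩
    ext v
    rw [LinearMap.mem_ker, ← Submodule.coe_eq_zero]
    exact (Submodule.Quotient.mk_eq_zero (L.comap W.subtype) (x := ⟨v.1.1, hVW v.2⟩)).symm
  obtain ⟨eK⟩ := hK
  have hL := hI.isFiniteLength_cls_smul_quotient hX'
  have hKf : IsFiniteLength R (LinearMap.ker p) :=
    eK.isFiniteLength (isFiniteLength_subquotient hL.1)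
  have hc1 : hI.shiftG (cls R (M ⧸ X')) = cls R (LinearMap.ker p) + cls R (B ⧸ V') := by
    rw [← hL.2, ← cls_congr eK]
    exact cls_quotient_of_le (X := L') (Y := V') (Submodule.comap_mono hLV) hL.1
  have hc2 : cls R (M ⧸ X') = cls R (B ⧸ V') + cls R (M ⧸ (X' ⊔ B)) := by
    obtain ⟨e'⟩ := nonempty_sup_quotient_equiv B X' (T := V) (inf_comm _ _)
    rw [cls_quotient_of_le (le_sup_left : X' ≤ X' ⊔ B) hX', ← cls_congr e']
  have hcard : Nat.card {X : Submodule R M // colon I X = X' ∧ X ⊔ I • ⊤ = Y} =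
      Nat.card (M →ₗ[R] LinearMap.ker p) := by
    rw [Nat.card_congr (e₁.trans (relComplEquiv hLW ⟨hLV, hVW⟩)), hker,
      Nat.card_congr ((complKerEquiv p s hs).trans (homModIEquiv I fun a ha k => ?_))]
    exact Subtype.ext (hQI a ha k)
  rw [hcard, ← homCard_cls hKf, hc1]
  change _ = _ * homCard M (cls R (M ⧸ (X' ⊔ B)))
  rw [homCard_add, hc2, homCard_add, mul_assoc]

end IsInvertibleIdeal

end Colon

/-! ### Series in the Dirichlet algebra -/

section Series

variable {R : Type u} [Ring R]

lemma Dir.ofG_add (a b : G R) : Dir.ofG (a + b) = Dir.ofG a * Dir.ofG b := by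
  rw [Dir.ofG, Dir.ofG, Dir.ofG, MvPowerSeries.monomial_mul_monomial, one_mul]

lemma Dir.ofG_zero : Dir.ofG (0 : G R) = 1 := rfl

lemma Dir.ofG_sum {ι : Type*} (s : Finset ι) (a : ι → G R) :
    Dir.ofG (∑ i ∈ s, a i) = ∏ i ∈ s, Dir.ofG (a i) := by
  classical
  induction s using Finset.induction_on with
  | empty => rfl
  | insert i s hi ih => rw [Finset.sum_insert hi, Finset.prod_insert hi, Dir.ofG_add, ih]

lemma Dir.coeff_ofG_self (a : G R) : MvPowerSeries.coeff a (Dir.ofG a) = 1 :=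
  MvPowerSeries.coeff_monomial_same _ _

lemma Dir.coeff_ofG_of_ne {a g : G R} (h : g ≠ a) : MvPowerSeries.coeff g (Dir.ofG a) = 0 :=
  MvPowerSeries.coeff_monomial_ne h _

lemma Dir.le_of_coeff_smul_ofG_mul_ne_zero {a g : G R} {c : ℂ} {f : Dir R}
    (h : MvPowerSeries.coeff g ((c • Dir.ofG a) * f) ≠ 0) : a ≤ g := by
  classical
  by_contra hn
  refine h ?_
  rw [smul_mul_assoc, MvPowerSeries.coeff_smul, Dir.ofG, MvPowerSeries.coeff_monomial_mul,
    if_neg hn, mul_zero]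

/-- `f` and `f'` agree in degrees less than `d`. -/
def AgreeBelow (d : ℕ) (f f' : Dir R) : Prop :=
  ∀ g : G R, g.degree < d → MvPowerSeries.coeff g f = MvPowerSeries.coeff g f'

/-- The series without terms of degree below `d` form an ideal. -/
lemma AgreeBelow.mul_left {d : ℕ} {f f' : Dir R} (h : AgreeBelow d f f') (b : Dir R) :
    AgreeBelow d (b * f) (b * f') := by
  classical
  intro g hg
  rw [MvPowerSeries.coeff_mul, MvPowerSeries.coeff_mul]
  refine Finset.sum_congr rfl fun x hx => ?_
  rw [h x.2 (lt_of_le_of_lt ?_ hg)]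
  rw [← Finset.HasAntidiagonal.mem_antidiagonal.mp hx, map_add]
  exact Nat.le_add_left _ _

lemma AgreeBelow.prod_one {ι : Type*} {d : ℕ} {f : ι → Dir R} (s : Finset ι)
    (h : ∀ i ∈ s, AgreeBelow d (f i) 1) : AgreeBelow d (∏ i ∈ s, f i) 1 := by
  classical
  induction s using Finset.induction_on with
  | empty => exact fun _ _ => rfl
  | insert i s hi ih =>
    rw [Finset.prod_insert hi]
    intro g hg
    rw [(ih fun j hj => h j (Finset.mem_insert_of_mem hj)).mul_left _ g hg, mul_one]
    exact h i (Finset.mem_insert_self _ _) g hg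

lemma IsLeftArithmetical.agreeBelow_tsum_one (hR : IsLeftArithmetical R) {ι : Type*} {d : ℕ}
    {f : ι → Dir R} (hf : Summable f) (i₀ : ι) (h₀ : f i₀ = 1)
    (h : ∀ i ≠ i₀, AgreeBelow d (f i) 0) : AgreeBelow d (∑' i, f i) 1 := by
  intro g hg
  rw [hR.coeff_tsum hf (s := {i₀}) fun i hi => h i (by simpa using hi) g hg,
    Finset.sum_singleton, h₀]

lemma agreeBelow_smul_ofG_mul {d : ℕ} (c : ℂ) {a : G R} (ha : d ≤ a.degree) (f : Dir R) :
    AgreeBelow d ((c • Dir.ofG a) * f) 0 := by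
  intro g hg
  by_contra hn
  have := Finsupp.degree_mono (Dir.le_of_coeff_smul_ofG_mul_ne_zero hn)
  omega

/-- Summation along the fibres of a map with finite fibres. -/
lemma hasSum_card_fiber {A : Type*} [AddCommMonoid A] [TopologicalSpace A] [ContinuousAdd A]
    [T3Space A] {α β : Type*} {π : α → β} {t : β → A} {a : A}
    (h : HasSum (fun x => t (π x)) a) (hfin : ∀ b, {x | π x = b}.Finite) :
    HasSum (fun b => Nat.card {x // π x = b} • t b) a := by
  have h' := (Equiv.sigmaFiberEquiv π).hasSum_iff.mpr h
  refine h'.sigma fun b => ?_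
  have : Fintype {x // π x = b} := (hfin b).fintype
  convert hasSum_fintype (β := {x // π x = b}) _ using 1
  refine Eq.trans ?_ (Finset.sum_congr rfl (f := fun _ => t b) fun x _ => congrArg t x.2.symm)
  rw [Finset.sum_const, Finset.card_univ, ← Nat.card_eq_fintype_card]

/-- The change of variable in a zeta series. -/
lemma IsLeftArithmetical.subst_tsum (hR : IsLeftArithmetical R) (I : Ideal R)
    {Φ : ModuleCat.{u} R → Dir R} {φ : G R → Dir R}
    (hΦ : ∀ N : ModuleCat.{u} R, IsFiniteLengthQuot I N → Φ N = φ (cls R N)) {ι : Type*}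
    {c : ι → G R} (hc : ∀ i, ∃ N : ModuleCat.{u} R, IsFiniteLengthQuot I N ∧ cls R N = c i)
    (hfin : ∀ g, {i | c i = g}.Finite) (hs : Summable fun i => φ (c i)) :
    SubstConverges I Φ (∑' i, Dir.ofG (c i)) ∧
      subst I Φ (∑' i, Dir.ofG (c i)) = ∑' i, φ (c i) := by
  have := hR.isTopologicalRing
  have := hR.t3Space
  have hsum : Summable fun i => Dir.ofG (c i) := hR.summable fun g =>
    (hfin g).subset fun i hi => by
      by_contra hn
      exact hi (Dir.coeff_ofG_of_ne fun h => hn h.symm)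
  have hterm : substTerm I Φ (∑' i, Dir.ofG (c i)) = fun g => Nat.card {i // c i = g} • φ g := by
    funext g
    have hcoeff : MvPowerSeries.coeff g (∑' i, Dir.ofG (c i)) = (Nat.card {i // c i = g} : ℂ) := by
      rw [hR.coeff_tsum hsum (s := (hfin g).toFinset) fun i hi =>
        Dir.coeff_ofG_of_ne fun h => hi (by simpa using h.symm)]
      rw [Finset.sum_congr rfl (g := fun _ => (1 : ℂ)) fun i hi => ?_]
      · rw [Finset.sum_const, nsmul_one, ← Set.ncard_eq_toFinset_card _ (hfin g)]
        rfl
      · have : c i = g := by simpa using hi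
        rw [this, Dir.coeff_ofG_self]
    rw [substTerm, hcoeff, Nat.cast_smul_eq_nsmul]
    by_cases hg : ∃ N : ModuleCat.{u} R, IsFiniteLengthQuot I N ∧ cls R N = g
    · rw [descend, dif_pos hg, hΦ _ hg.choose_spec.1, hg.choose_spec.2]
    -- The default value `0` of `descend` is harmless: at such a `g` the coefficient vanishes.
    · have : IsEmpty {i // c i = g} := ⟨fun i => hg (i.2 ▸ hc i.1)⟩
      rw [Nat.card_of_isEmpty, zero_smul, zero_smul]
  have hfib := hasSum_card_fiber (π := c) (t := φ) hs.hasSum hfin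
  rw [← hterm] at hfib
  refine ⟨⟨fun N N' hN hN' h => ?_, hfib.summable⟩, hfib.tsum_eq⟩
  rw [hΦ N hN, hΦ N' hN', h]

end Series

/-! ### The weights -/

section Weights

variable {R : Type u} [Ring R] {I : Ideal R} [I.IsTwoSided] (hI : IsInvertibleIdeal I)
variable (M : Type u) [AddCommGroup M] [Module R M]

namespace IsInvertibleIdeal

/-- `|Hom(M, I^k ⊗ N)| [I^k ⊗ N]` as a function of the class of `N`. -/
def powWeight (k : ℕ) (g : G R) : Dir R :=
  homCard M (hI.shiftG^[k] g) • Dir.ofG (hI.shiftG^[k] g)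

/-- The function `⟨M/IM, -⟩_j^I` on classes. -/
def bracketWeight (j : ℕ) (g : G R) : Dir R :=
  (homCard M g)⁻¹ • ∏ k ∈ Finset.range (j + 1), hI.powWeight M k g

/-- The weight of `M/X` in the remainder series. -/
def headWeight (j : ℕ) (g : G R) : Dir R := (homCard M g)⁻¹ • hI.powWeight M j g

/-- The weight of `M/(X + IM)` in the remainder series. -/
def tailWeight (j : ℕ) (g : G R) : Dir R := ∏ k ∈ Finset.range j, hI.powWeight M k g

lemma powWeight_add (k : ℕ) (a b : G R) :
    hI.powWeight M k (a + b) = hI.powWeight M k a * hI.powWeight M k b := by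
  rw [powWeight, powWeight, powWeight, iterate_map_add, homCard_add, Dir.ofG_add,
    smul_mul_smul_comm]

lemma powWeight_zero (k : ℕ) : hI.powWeight M k 0 = 1 := by
  rw [powWeight, iterate_map_zero, homCard_zero, Dir.ofG_zero, one_smul]

lemma powWeight_shift (k : ℕ) (a : G R) :
    hI.powWeight M k (hI.shiftG a) = hI.powWeight M (k + 1) a := by
  rw [powWeight, powWeight, Function.iterate_succ_apply]

lemma headWeight_add (j : ℕ) (a b : G R) :
    hI.headWeight M j (a + b) = hI.headWeight M j a * hI.headWeight M j b := by
  rw [headWeight, headWeight, headWeight, homCard_add, powWeight_add, smul_mul_smul_comm, mul_inv]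

lemma tailWeight_add (j : ℕ) (a b : G R) :
    hI.tailWeight M j (a + b) = hI.tailWeight M j a * hI.tailWeight M j b := by
  rw [tailWeight, tailWeight, tailWeight, ← Finset.prod_mul_distrib]
  exact Finset.prod_congr rfl fun k _ => hI.powWeight_add M k a b

lemma bracketWeight_eq (j : ℕ) (a : G R) :
    hI.bracketWeight M j a = hI.headWeight M j a * hI.tailWeight M j a := by
  rw [bracketWeight, headWeight, tailWeight, Finset.prod_range_succ, smul_mul_assoc, mul_comm]

lemma bracketWeight_add (j : ℕ) (a b : G R) :
    hI.bracketWeight M j (a + b) = hI.bracketWeight M j a * hI.bracketWeight M j b := by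
  simp only [bracketWeight_eq, headWeight_add, tailWeight_add]
  ring

lemma headWeight_zero (j : ℕ) : hI.headWeight M j 0 = 1 := by
  rw [headWeight, powWeight_zero, homCard_zero, inv_one, one_smul]

lemma tailWeight_zero (j : ℕ) : hI.tailWeight M j 0 = 1 :=
  Finset.prod_eq_one fun k _ => hI.powWeight_zero M k

lemma bracketWeight_zero (j : ℕ) : hI.bracketWeight M j 0 = 1 := by
  rw [bracketWeight_eq, headWeight_zero, tailWeight_zero, one_mul]

lemma degree_iterate_shiftG (k : ℕ) (g : G R) : (hI.shiftG^[k] g).degree = g.degree := by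
  induction k with
  | zero => rfl
  | succ k ih => rw [Function.iterate_succ_apply', degree_shiftG, ih]

lemma tailWeight_eq (j : ℕ) (g : G R) : hI.tailWeight M j g =
    (∏ k ∈ Finset.range j, homCard M (hI.shiftG^[k] g)) •
      Dir.ofG (∑ k ∈ Finset.range j, hI.shiftG^[k] g) := by
  rw [Dir.ofG_sum, tailWeight]
  exact Finset.prod_smul _ _ _

lemma degree_sum_shiftG (j : ℕ) (g : G R) :
    (∑ k ∈ Finset.range j, hI.shiftG^[k] g).degree = j * g.degree := by
  rw [map_sum, Finset.sum_congr rfl fun k _ => hI.degree_iterate_shiftG k g, Finset.sum_const,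
    Finset.card_range, smul_eq_mul]

/-- The monomial of `tailWeight j g` is a product of `j` shifts of `g`, each of degree at least `1`.
-/
lemma agreeBelow_tailWeight_mul (j : ℕ) {g : G R} (hg : g ≠ 0) (f : Dir R) :
    AgreeBelow j (hI.tailWeight M j g * f) 0 := by
  rw [tailWeight_eq]
  refine agreeBelow_smul_ofG_mul _ ?_ f
  rw [degree_sum_shiftG]
  exact Nat.le_mul_of_pos_right _ (Nat.pos_of_ne_zero fun h => hg ((Finsupp.degree_eq_zero_iff g).mp h))

lemma agreeBelow_bracketWeight (j : ℕ) {g : G R} (hg : g ≠ 0) :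
    AgreeBelow (j + 1) (hI.bracketWeight M j g) 0 := by
  -- The product in `bracketWeight j` has `j + 1` factors, hence is `tailWeight (j + 1)`; the scalar
  -- is fed in as a constant series.
  have h := hI.agreeBelow_tailWeight_mul M (j + 1) hg (MvPowerSeries.C (homCard M g)⁻¹)
  rwa [mul_comm, ← MvPowerSeries.smul_eq_C_mul] at h

lemma finite_iterate_shiftG_le (k : ℕ) (g : G R) : {a : G R | hI.shiftG^[k] a ≤ g}.Finite := by
  classical
  exact (Set.finite_Iic g).preimage (hI.shiftG_injective.iterate k).injOn

/-- Series of weights are summable. -/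
lemma summable_headWeight_mul (hR : IsLeftArithmetical R) {ι : Type*} {c : ι → G R}
    (hfin : ∀ g, {i | c i = g}.Finite) (j : ℕ) (f : ι → Dir R) :
    Summable fun i => hI.headWeight M j (c i) * f i := by
  refine hR.summable fun g => ?_
  -- A contributing term has its head monomial, the `j`-th shift of `c i`, dividing `g`. Since the
  -- shift is injective, only finitely many classes qualify, whatever `f` is.
  refine ((hI.finite_iterate_shiftG_le j g).biUnion fun a _ =>
    hfin a).subset fun i hi => ?_
  refine Set.mem_biUnion (x := c i) ?_ rfl
  change MvPowerSeries.coeff g (hI.headWeight M j (c i) * f i) ≠ 0 at hi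
  rw [headWeight, powWeight, smul_smul] at hi
  exact Dir.le_of_coeff_smul_ofG_mul_ne_zero hi

variable {M} in
/-- The bracket is given by the weight on classes. -/
lemma bracket_eq [Module.Projective R M] (j : ℕ) (N : ModuleCat.{u} R)
    (hN : IsFiniteLengthQuot I N) :
    bracket I (fun _ => ModI I M) j N = hI.bracketWeight M j (cls R N) := by
  rw [bracket, bracketWeight, homCard_cls hN.1, Nat.card_congr (homModIEquiv I hN.2)]
  congr 1
  refine Finset.prod_congr rfl fun k _ => ?_
  obtain ⟨h1, h2⟩ := hI.isFiniteLength_cls_tensor_pow hN.1 k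
  rw [powWeight, ← h2, homCard_cls h1,
    Nat.card_congr (homModIEquiv I (smul_tensor_pow_eq_zero hN.2 k))]

end IsInvertibleIdeal

end Weights

/-! ### The recursion for the zeta function of `M` -/

section Recursion

variable {R : Type u} [Ring R] {I : Ideal R} [I.IsTwoSided]
variable {M : Type u} [AddCommGroup M] [Module R M]

omit [I.IsTwoSided] in
lemma IsLeftArithmetical.finite_finColength (hR : IsLeftArithmetical R) (N : Type u)
    [AddCommGroup N] [Module R N] [Module.Finite R N] (g : G R) :
    {X : FinColength R N | cls R (N ⧸ X.1) = g}.Finite := by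
  refine Set.Finite.of_finite_image ((hR.finite_submodules g N).subset ?_)
    Subtype.val_injective.injOn
  rintro _ ⟨X, hX, rfl⟩
  exact ⟨X.2, hX⟩

-- Nakayama's lemma for the finitely generated module `M/X`.
omit [I.IsTwoSided] in
lemma eq_top_of_sup_smul_eq_top [Module.Finite R M] (hIJ : I ≤ Ring.jacobson R)
    {X : Submodule R M} (h : X ⊔ I • ⊤ = ⊤) : X = ⊤ := by
  have h1 : (⊤ : Submodule R (M ⧸ X)) = ⊥ := by
    refine Submodule.FG.eq_bot_of_le_jacobson_smul Module.Finite.fg_top ?_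
    calc (⊤ : Submodule R (M ⧸ X)) = (X ⊔ I • ⊤).map X.mkQ := by
          rw [h, Submodule.map_top, Submodule.range_mkQ]
      _ = I • ⊤ := by
          rw [Submodule.map_sup, Submodule.mkQ_map_self, bot_sup_eq, Submodule.map_smul'',
            Submodule.map_top, Submodule.range_mkQ]
      _ ≤ _ := Submodule.smul_mono hIJ le_rfl
  rw [← Submodule.Quotient.subsingleton_iff]
  exact (Submodule.subsingleton_iff R).mp (subsingleton_of_bot_eq_top h1.symm)

/-- The submodules of finite colength of `M` between `IM` and `B`. -/
abbrev Between (I : Ideal R) (B : Submodule R M) : Type u :=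
  {Y : Submodule R M // I • ⊤ ≤ Y ∧ Y ≤ B ∧ IsFiniteLength R (M ⧸ Y)}

omit [I.IsTwoSided] in
/-- When `B/IM` is isomorphic to `M/IM`, the submodules between `IM` and `B` are parametrised by
those of `M/IM`. -/
lemma exists_between_equiv
    (hiso : ∀ X X' : FinColength R (ModI I M), Nonempty (X.1 ≃ₗ[R] X'.1))
    {B : Submodule R M} (hIB : I • ⊤ ≤ B) (hB : IsFiniteLength R (M ⧸ B)) :
    ∃ e : Between I B ≃ FinColength R (ModI I M), ∀ Y,
      cls R (ModI I M ⧸ (e Y).1) = cls R (B ⧸ Y.1.comap B.subtype) := by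
  let L : Submodule R M := I • ⊤
  let D := B ⧸ L.comap B.subtype
  obtain ⟨ε⟩ : Nonempty (D ≃ₗ[R] ModI I M) := by
    obtain ⟨e⟩ := nonempty_map_equiv_modI hiso hIB hB
    let p : B →ₗ[R] B.map L.mkQ := L.mkQ.restrict fun x hx => Submodule.mem_map_of_mem hx
    have hp : Function.Surjective p := by
      rintro ⟨_, x, hx, rfl⟩
      exact ⟨⟨x, hx⟩, rfl⟩
    refine ⟨((Submodule.quotEquivOfEq _ _ ?_).trans (p.quotKerEquivOfSurjective hp)).trans e⟩
    ext b
    rw [LinearMap.mem_ker, ← Submodule.coe_eq_zero]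
    exact (Submodule.Quotient.mk_eq_zero L (x := b.1)).symm
  let ω : Set.Icc L B ≃o Submodule R (ModI I M) :=
    (liftSubIso hIB).symm.trans (Submodule.orderIsoMapComap ε)
  -- Third isomorphism theorem in `B/IM`, transported to `M/IM` along `ε`.
  have hω : ∀ Y : Set.Icc L B,
      Nonempty ((B ⧸ Y.1.comap B.subtype) ≃ₗ[R] ModI I M ⧸ ω Y) := fun Y => by
    exact ⟨(Submodule.quotientQuotientEquivQuotient _ _ (Submodule.comap_mono Y.2.1)).symm.trans
      (Submodule.Quotient.equiv _ _ ε rfl)⟩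
  have hfl : ∀ Y : Set.Icc L B, IsFiniteLength R (M ⧸ Y.1) ↔ IsFiniteLength R (ModI I M ⧸ ω Y) :=
    fun Y => by
      obtain ⟨e⟩ := hω Y
      exact ⟨fun h => e.isFiniteLength (isFiniteLength_subquotient h), fun h =>
        isFiniteLength_quotient_of_subquotient Y.2.2 (e.symm.isFiniteLength h) hB⟩
  refine ⟨{
    toFun := fun Y => ⟨ω ⟨Y.1, Y.2.1, Y.2.2.1⟩, (hfl _).mp Y.2.2.2⟩
    invFun := fun T => ⟨(ω.symm T.1).1, (ω.symm T.1).2.1, (ω.symm T.1).2.2,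
      (hfl _).mpr (by rw [OrderIso.apply_symm_apply]; exact T.2)⟩
    left_inv := fun Y => Subtype.ext (by simp)
    right_inv := fun T => Subtype.ext (ω.apply_symm_apply T.1) }, fun Y => ?_⟩
  obtain ⟨e⟩ := hω ⟨Y.1, Y.2.1, Y.2.2.1⟩
  exact (cls_congr e).symm

namespace IsInvertibleIdeal

variable (hI : IsInvertibleIdeal I)

variable (M) in
/-- The series obtained from the zeta function of `M/IM` by the change of variable
`⟨M/IM, -⟩_j^I`. -/
def factorSeries (j : ℕ) : Dir R :=
  ∑' Y : FinColength R (ModI I M), hI.bracketWeight M j (cls R (ModI I M ⧸ Y.1))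

/-- The terms of the remainder series. -/
def remainderTerm (j : ℕ) (X : FinColength R M) : Dir R :=
  hI.headWeight M j (cls R (M ⧸ X.1)) * hI.tailWeight M j (cls R (M ⧸ (X.1 ⊔ I • ⊤)))

variable (M) in
/-- What remains of the zeta function of `M` after `j` factors have been split off. -/
def remainder (j : ℕ) : Dir R := ∑' X : FinColength R M, hI.remainderTerm j X

lemma summable_bracketWeight (hR : IsLeftArithmetical R) {ι : Type*} {c : ι → G R}
    (hfin : ∀ g, {i | c i = g}.Finite) (j : ℕ) :
    Summable fun i => hI.bracketWeight M j (c i) := by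
  simp only [bracketWeight_eq]
  exact hI.summable_headWeight_mul M hR hfin j _

lemma summable_remainderTerm (hR : IsLeftArithmetical R) [Module.Finite R M] (j : ℕ) :
    Summable fun X : FinColength R M => hI.remainderTerm j X :=
  hI.summable_headWeight_mul M hR (hR.finite_finColength M) j _

lemma agreeBelow_factorSeries (hR : IsLeftArithmetical R) [Module.Finite R M] (j : ℕ) :
    AgreeBelow (j + 1) (hI.factorSeries M j) 1 := by
  refine hR.agreeBelow_tsum_one (hI.summable_bracketWeight hR (hR.finite_finColength _) j)
    ⟨⊤, .of_subsingleton⟩ ?_ fun Y hY => hI.agreeBelow_bracketWeight M j ?_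
  · rw [cls_of_subsingleton, bracketWeight_zero]
  · rw [Ne, cls_eq_zero_iff Y.2, Submodule.Quotient.subsingleton_iff]
    exact fun h => hY (Subtype.ext h)

/-- If `X ≠ M`, then `X + IM ≠ M` by Nakayama, so the tail weight sits at a nonzero class and pushes
the term into degree at least `j`. -/
lemma agreeBelow_remainder (hR : IsLeftArithmetical R) [Module.Finite R M]
    (hIJ : I ≤ Ring.jacobson R) (j : ℕ) : AgreeBelow j (hI.remainder M j) 1 := by
  refine hR.agreeBelow_tsum_one (hI.summable_remainderTerm hR j) ⟨⊤, .of_subsingleton⟩ ?_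
    fun X hX => ?_
  · rw [remainderTerm, cls_of_subsingleton, headWeight_zero, one_mul]
    have : Subsingleton (M ⧸ ((⊤ : Submodule R M) ⊔ I • ⊤)) := by
      rw [Submodule.Quotient.subsingleton_iff, top_sup_eq]
    rw [cls_of_subsingleton, tailWeight_zero]
  · rw [remainderTerm, mul_comm]
    refine hI.agreeBelow_tailWeight_mul M j ?_ _
    rw [Ne, cls_eq_zero_iff (isFiniteLength_quotient_of_le le_sup_left X.2),
      Submodule.Quotient.subsingleton_iff]
    exact fun h => hX (Subtype.ext (eq_top_of_sup_smul_eq_top hIJ h))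

lemma remainderTerm_zero (hR : IsLeftArithmetical R) [Module.Finite R M] (X : FinColength R M) :
    hI.remainderTerm 0 X = zetaTerm R M X := by
  rw [remainderTerm, headWeight, powWeight, tailWeight, Finset.prod_range_zero, mul_one, smul_smul,
    Function.iterate_zero, id, inv_mul_cancel₀ (homCard_ne_zero hR _), one_smul, zetaTerm]

variable [Module.Finite R M] [Module.Projective R M]

/-- The contribution of a pair `(X', Y)` to the remainder series. -/
lemma card_fiber_smul (hR : IsLeftArithmetical R)
    (hiso : ∀ X X' : FinColength R (ModI I M), Nonempty (X.1 ≃ₗ[R] X'.1)) (j : ℕ)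
    (X' : FinColength R M) (Y : Between I (X'.1 ⊔ I • ⊤)) :
    Nat.card {X : Submodule R M // colon I X = X'.1 ∧ X ⊔ I • ⊤ = Y.1} •
      (hI.headWeight M j (hI.shiftG (cls R (M ⧸ X'.1))) * hI.bracketWeight M j (cls R (M ⧸ Y.1))) =
    hI.remainderTerm (j + 1) X' *
      hI.bracketWeight M j (cls R (↥(X'.1 ⊔ I • ⊤) ⧸ Y.1.comap (X'.1 ⊔ I • ⊤).subtype)) := by
  have hcard := hI.card_fiber hiso X'.2 Y.2.2.2 Y.2.1 Y.2.2.1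
  -- Splitting `[M/Y]` along `X' + IM` isolates the bracket weight of `(X' + IM)/Y`, which cancels.
  -- What remains is a scalar identity, supplied by `card_fiber`.
  rw [cls_quotient_of_le Y.2.2.1 Y.2.2.2, bracketWeight_add, ← Nat.cast_smul_eq_nsmul ℂ,
    mul_comm (hI.bracketWeight M j _), ← mul_assoc, ← smul_mul_assoc]
  congr 1
  rw [remainderTerm, headWeight, headWeight, powWeight_shift, bracketWeight, ← tailWeight,
    smul_mul_smul_comm, smul_smul, smul_mul_assoc]
  congr 1
  have h1 := homCard_ne_zero (M := M) hR (cls R (M ⧸ X'.1))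
  have h2 := homCard_ne_zero (M := M) hR (hI.shiftG (cls R (M ⧸ X'.1)))
  have h3 := homCard_ne_zero (M := M) hR (cls R (M ⧸ (X'.1 ⊔ I • ⊤)))
  field_simp
  linear_combination hcard

/-- One step of the recursion. -/
lemma remainder_eq_mul (hR : IsLeftArithmetical R)
    (hiso : ∀ X X' : FinColength R (ModI I M), Nonempty (X.1 ≃ₗ[R] X'.1)) (j : ℕ) :
    hI.remainder M j = hI.factorSeries M j * hI.remainder M (j + 1) := by
  have := hR.isTopologicalRing
  have := hR.t3Space
  let p (X' : FinColength R M) (Y : Submodule R M) : Prop :=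
    I • ⊤ ≤ Y ∧ Y ≤ X'.1 ⊔ I • ⊤ ∧ IsFiniteLength R (M ⧸ Y)
  let π (X : FinColength R M) : {x : FinColength R M × Submodule R M // p x.1 x.2} :=
    ⟨(⟨colon I X.1, isFiniteLength_quotient_of_le (le_colon X.1) X.2⟩, X.1 ⊔ I • ⊤),
      le_sup_right, sup_le_sup_right (le_colon X.1) _,
      isFiniteLength_quotient_of_le le_sup_left X.2⟩
  let t (x : {x : FinColength R M × Submodule R M // p x.1 x.2}) : Dir R :=
    hI.headWeight M j (hI.shiftG (cls R (M ⧸ x.1.1.1))) *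
      hI.bracketWeight M j (cls R (M ⧸ x.1.2))
  -- The head weight of the factor `M/Y` merges with its tail weight into a bracket weight, so the
  -- term depends on `X` only through the pair.
  have ht : ∀ X, hI.remainderTerm j X = t (π X) := fun X => by
    rw [remainderTerm, hI.cls_quotient_eq_shift_add X.2, headWeight_add, mul_assoc,
      ← bracketWeight_eq]
  let fib (x : {x : FinColength R M × Submodule R M // p x.1 x.2}) :
      {X // π X = x} ≃ {X : Submodule R M // colon I X = x.1.1.1 ∧ X ⊔ I • ⊤ = x.1.2} :=
    { toFun := fun X => ⟨X.1.1, congrArg (fun y => y.1.1.1) X.2, congrArg (fun y => y.1.2) X.2⟩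
      invFun := fun X => ⟨⟨X.1, hI.isFiniteLength_of_colon_sup (by rw [X.2.1]; exact x.1.1.2)
        (by rw [X.2.2]; exact x.2.2.2)⟩,
        Subtype.ext (Prod.ext (Subtype.ext X.2.1) X.2.2)⟩
      left_inv := fun X => rfl
      right_inv := fun X => rfl }
  -- `Nat.card` of an infinite type is `0`, so the nonzero count from `card_fiber` gives finiteness.
  have hfin : ∀ x, {X | π X = x}.Finite := fun x => by
    have hcard := hI.card_fiber hiso x.1.1.2 x.2.2.2 x.2.1 x.2.2.1
    have hne : Nat.card {X : Submodule R M // colon I X = x.1.1.1 ∧ X ⊔ I • ⊤ = x.1.2} ≠ 0 := by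
      intro h0
      rw [h0, Nat.cast_zero, zero_mul] at hcard
      exact mul_ne_zero (homCard_ne_zero hR _) (homCard_ne_zero hR _) hcard.symm
    have := Nat.finite_of_card_ne_zero hne
    exact Set.finite_coe_iff.mp (Finite.of_equiv _ (fib x).symm)
  have h1 : HasSum (fun X => t (π X)) (hI.remainder M j) := by
    rw [← funext ht]
    exact (hI.summable_remainderTerm hR j).hasSum
  have h2 := (Equiv.subtypeProdEquivSigmaSubtype p).symm.hasSum_iff.mpr
    (hasSum_card_fiber h1 hfin)
  -- For fixed `X'`, summing over `Y` between `IM` and `X' + IM` reproduces `factorSeries M j`.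
  have h3 := h2.sigma (g := fun X' => hI.remainderTerm (j + 1) X' * hI.factorSeries M j)
    fun X' => by
      obtain ⟨e, he⟩ := exists_between_equiv hiso (le_sup_right : I • ⊤ ≤ X'.1 ⊔ I • ⊤)
        (isFiniteLength_quotient_of_le le_sup_left X'.2)
      have h := e.hasSum_iff.mpr (hI.summable_bracketWeight (M := M) hR
        (hR.finite_finColength (ModI I M)) j).hasSum
      have h' := h.mul_left (hI.remainderTerm (j + 1) X')
      refine Eq.mp (congrArg (fun F => HasSum F _) (funext fun Y => Eq.symm ?_)) h'
      change Nat.card {X // π X = ⟨(X', Y.1), Y.2⟩} • t ⟨(X', Y.1), Y.2⟩ =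
        _ * hI.bracketWeight M j (cls R (ModI I M ⧸ (e Y).1))
      rw [he Y, Nat.card_congr (fib _)]
      exact hI.card_fiber_smul hR hiso j X' Y
  have h4 := (hI.summable_remainderTerm (M := M) hR (j + 1)).hasSum.mul_right (hI.factorSeries M j)
  rw [mul_comm]
  exact h3.unique h4

lemma zeta_eq_prod_mul_remainder (hR : IsLeftArithmetical R)
    (hiso : ∀ X X' : FinColength R (ModI I M), Nonempty (X.1 ≃ₗ[R] X'.1)) (j : ℕ) :
    zeta R M = (∏ i ∈ Finset.range j, hI.factorSeries M i) * hI.remainder M j := by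
  induction j with
  | zero =>
    rw [Finset.prod_range_zero, one_mul, remainder, zeta]
    exact tsum_congr fun X => (hI.remainderTerm_zero hR X).symm
  | succ j ih => rw [Finset.prod_range_succ, mul_assoc, ← hI.remainder_eq_mul hR hiso, ih]

lemma hasProd_factorSeries (hR : IsLeftArithmetical R) (hIJ : I ≤ Ring.jacobson R)
    (hiso : ∀ X X' : FinColength R (ModI I M), Nonempty (X.1 ≃ₗ[R] X'.1)) :
    HasProd (hI.factorSeries M) (zeta R M) := by
  -- Up to degree `deg g`, the remainder after `deg g + 1` factors is `1`, and so is every factor of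
  -- index beyond `deg g`. Any finite set containing the first `deg g + 1` indices thus gives the
  -- right coefficient.
  refine hR.tendsto_iff.mpr fun g => Filter.eventually_atTop.mpr
    ⟨Finset.range (g.degree + 1), fun s hs => ?_⟩
  rw [hI.zeta_eq_prod_mul_remainder hR hiso (g.degree + 1),
    (hI.agreeBelow_remainder hR hIJ (g.degree + 1)).mul_left _ g (Nat.lt_succ_self _), mul_one,
    ← Finset.prod_sdiff hs, mul_comm, AgreeBelow.mul_left (d := g.degree + 1) (f' := 1) ?_ _ g
    (Nat.lt_succ_self _), mul_one]
  refine AgreeBelow.prod_one _ fun i hi a ha => hI.agreeBelow_factorSeries hR i a ?_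
  have := Finset.mem_sdiff.mp hi
  rw [Finset.mem_range] at this
  omega

end IsInvertibleIdeal

end Recursion

/-! ### The factors of the proliferation -/

section Factors

variable {R : Type u} [Ring R] {I : Ideal R} [I.IsTwoSided]
variable {M : Type u} [AddCommGroup M] [Module R M]

omit [I.IsTwoSided] in
lemma smul_modI_eq_zero (a : R) (ha : a ∈ I) (m : ModI I M) : a • m = 0 := by
  obtain ⟨m, rfl⟩ := (I • (⊤ : Submodule R M)).mkQ_surjective m
  rw [← map_smul]
  exact (Submodule.Quotient.mk_eq_zero _).mpr (Submodule.smul_mem_smul ha trivial)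

omit [I.IsTwoSided] in
lemma isFiniteLengthQuot_quotient (Y : FinColength R (ModI I M)) :
    IsFiniteLengthQuot I (ModI I M ⧸ Y.1) := by
  refine ⟨Y.2, fun a ha n => ?_⟩
  obtain ⟨m, rfl⟩ := Y.1.mkQ_surjective n
  rw [← map_smul, smul_modI_eq_zero a ha, map_zero]

lemma IsLeftArithmetical.summable_zetaTerm (hR : IsLeftArithmetical R) (N : Type u)
    [AddCommGroup N] [Module R N] [Module.Finite R N] : Summable (zetaTerm R N) :=
  hR.summable fun g => (hR.finite_finColength N g).subset fun X hX => by
    by_contra hn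
    exact hX (Dir.coeff_ofG_of_ne fun h => hn h.symm)

lemma IsInvertibleIdeal.subst_zeta (hI : IsInvertibleIdeal I) (hR : IsLeftArithmetical R)
    [Module.Finite R M] [Module.Projective R M] (j : ℕ) :
    SubstConverges I (bracket I (fun _ => ModI I M) j) (zeta R (ModI I M)) ∧
      subst I (bracket I (fun _ => ModI I M) j) (zeta R (ModI I M)) = hI.factorSeries M j :=
  hR.subst_tsum I (φ := hI.bracketWeight M j) (fun N hN => hI.bracket_eq j N hN)
    (c := fun Y : FinColength R (ModI I M) => cls R (ModI I M ⧸ Y.1))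
    (fun Y => ⟨ModuleCat.of R (ModI I M ⧸ Y.1), isFiniteLengthQuot_quotient Y, rfl⟩)
    (hR.finite_finColength _) (hI.summable_bracketWeight hR (hR.finite_finColength _) j)

lemma bracket_congr {P Q : ℕ → Type u} [∀ j, AddCommGroup (P j)] [∀ j, Module R (P j)]
    [∀ j, AddCommGroup (Q j)] [∀ j, Module R (Q j)] (h : ∀ j, Nonempty (P j ≃ₗ[R] Q j)) (j : ℕ) :
    bracket I P j = bracket I Q j := by
  have hcard : ∀ (i : ℕ) (N : Type u) [AddCommGroup N] [Module R N],
      Nat.card (P i →ₗ[R] N) = Nat.card (Q i →ₗ[R] N) := fun i N _ _ => by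
    obtain ⟨e⟩ := h i
    exact Nat.card_congr ⟨fun f => f ∘ₗ e.symm.toLinearMap, fun f => f ∘ₗ e.toLinearMap,
      fun f => by ext; simp, fun f => by ext; simp⟩
  funext N
  simp only [bracket, hcard]

variable (hiso : ∀ X X' : FinColength R (ModI I M), Nonempty (X.1 ≃ₗ[R] X'.1))

include hiso

omit [I.IsTwoSided] in
lemma ChainClass.nonempty_rep_equiv (P : ChainClass I M) (j : ℕ) :
    Nonempty (P.rep j ≃ₗ[R] ModI I M) := by
  obtain ⟨e⟩ := hiso ⟨P.out.Y j, P.out.finColength j⟩ ⟨⊤, .of_subsingleton⟩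
  exact ⟨e.trans Submodule.topEquiv⟩

-- The requirement that `X` be isomorphic to `P_j` costs nothing: all finite colength submodules of
-- `M/IM`, hence of its isomorphic copy `P_{j+1}`, are isomorphic to one another.
omit [I.IsTwoSided] in
lemma ChainClass.exists_equiv (P : ChainClass I M) (j : ℕ) :
    ∃ e : FinColengthIso R (P.rep (j + 1)) (P.rep j) ≃ FinColength R (ModI I M),
      ∀ X, zetaTerm R (ModI I M) (e X) = partialZetaTerm R (P.rep (j + 1)) (P.rep j) X := by
  obtain ⟨ε⟩ := ChainClass.nonempty_rep_equiv hiso P (j + 1)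
  let ω := Submodule.orderIsoMapComap ε
  let q (X : Submodule R (P.rep (j + 1))) : (P.rep (j + 1) ⧸ X) ≃ₗ[R] ModI I M ⧸ ω X :=
    Submodule.Quotient.equiv _ _ ε rfl
  refine ⟨{
    toFun := fun X => ⟨ω X.1, (q X.1).isFiniteLength X.2.1⟩
    invFun := fun Y => ⟨ω.symm Y.1, ?_, ?_⟩
    left_inv := fun X => Subtype.ext (ω.symm_apply_apply X.1)
    right_inv := fun Y => Subtype.ext (ω.apply_symm_apply Y.1) }, fun X => ?_⟩
  · refine (q _).symm.isFiniteLength ?_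
    rw [OrderIso.apply_symm_apply]
    exact Y.2
  · obtain ⟨e⟩ := hiso Y ⟨P.out.Y j, P.out.finColength j⟩
    exact ⟨((ε.submoduleMap _).trans
      (LinearEquiv.ofEq _ _ (ω.apply_symm_apply Y.1))).trans e⟩
  · rw [zetaTerm, partialZetaTerm]
    exact congrArg Dir.ofG (cls_congr (q X.1)).symm

omit [I.IsTwoSided] in
lemma ChainClass.partialZeta_eq (P : ChainClass I M) (j : ℕ) :
    partialZeta R (P.rep (j + 1)) (P.rep j) = zeta R (ModI I M) := by
  obtain ⟨e, he⟩ := ChainClass.exists_equiv hiso P j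
  rw [partialZeta, zeta, ← e.tsum_eq]
  exact tsum_congr fun X => (he X).symm

lemma ChainClass.bracket_eq (P : ChainClass I M) (j : ℕ) :
    bracket I P.rep j = bracket I (fun _ => ModI I M) j :=
  bracket_congr (ChainClass.nonempty_rep_equiv hiso P) j

omit [I.IsTwoSided] in
/-- All chains are isomorphic. -/
lemma ChainClass.nonempty_unique : Nonempty (Unique (ChainClass I M)) := by
  refine ⟨⟨⟨Quotient.mk _ ⟨fun _ => ⊤, fun _ _ _ => le_rfl, fun _ => .of_subsingleton,
    ⟨0, fun _ _ => rfl⟩⟩⟩, fun P => ?_⟩⟩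
  induction P using Quotient.inductionOn with
  | h Y => exact Quotient.sound fun j => hiso ⟨Y.Y j, Y.finColength j⟩ ⟨⊤, .of_subsingleton⟩

end Factors

end BushnellReiner

end

open BushnellReiner in
theorem mainTheorem4 {R : Type u} [Ring R] (hR : IsLeftArithmetical R)
    {M : Type u} [AddCommGroup M] [Module R M] [Module.Finite R M] [Module.Projective R M]
    (I : Ideal R) [I.IsTwoSided] (hI : IsInvertibleIdeal I) (hIJ : I ≤ Ring.jacobson R)
    (hiso : ∀ X X' : FinColength R (ModI I M), Nonempty (X.1 ≃ₗ[R] X'.1)) :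
    -- the zeta functions, the changes of variable and the proliferation are well defined
    Summable (zetaTerm R M) ∧ Summable (zetaTerm R (ModI I M)) ∧
    (∀ j, SubstConverges I (bracket I (fun _ => ModI I M) j) (zeta R (ModI I M))) ∧
    ProlifConverges I M ∧
    -- the two equalities
    zeta R M = prolif I M ∧
    HasProd (fun j : ℕ => subst I (bracket I (fun _ => ModI I M) j) (zeta R (ModI I M)))
      (zeta R M) := by
  have := hR.t3Space
  have hprod := hI.hasProd_factorSeries hR hIJ hiso
  have hfactor : ∀ P : ChainClass I M, prolifFactor P = hI.factorSeries M := fun P => by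
    funext j
    rw [prolifFactor, ChainClass.partialZeta_eq hiso, ChainClass.bracket_eq hiso,
      (hI.subst_zeta hR j).2]
  have htprod : ∀ P : ChainClass I M, ∏' j, prolifFactor P j = zeta R M := fun P => by
    rw [hfactor]
    exact hprod.tprod_eq
  obtain ⟨hu⟩ := ChainClass.nonempty_unique hiso
  refine ⟨hR.summable_zetaTerm M, hR.summable_zetaTerm _, fun j => (hI.subst_zeta hR j).1,
    ⟨fun P j => ⟨?_, ?_⟩, fun P => ?_, ?_⟩, ?_, ?_⟩
  · obtain ⟨e, he⟩ := ChainClass.exists_equiv hiso P j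
    rw [← funext he]
    exact e.summable_iff.mpr (hR.summable_zetaTerm (ModI I M))
  · rw [ChainClass.partialZeta_eq hiso, ChainClass.bracket_eq hiso]
    exact (hI.subst_zeta hR j).1
  · rw [hfactor]
    exact hprod.multipliable
  -- There is exactly one chain class, so the outer sum is its single term.
  · exact (hasSum_unique _).summable
  · rw [prolif, (hasSum_unique _).tsum_eq, htprod]
  · simpa only [(hI.subst_zeta hR _).2] using hprod
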